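/- Let $L\ge 1$ be an integer and $r_n\ge 0$ real. *Channel.* The transmitter sends a message in at most $L$ blocks of one channel use each over a SISO channel: in block $i$ the receiver observes $y_i=\sqrt{\eta}\,h\,x_i+n_i$, where $\eta$ is the SNR, $h\sim\mathcal{CN}(0,1)$ is constant over the $L$ blocks and known only to the receiver, and $n_1,\dots,n_L\sim\mathcal{CN}(0,1)$ are independent of each other and of $h$. The total mutual information after $l$ blocks is $I_l=l\log_2(1+\eta|h|^2)$. *Permutation codes.* A unit-length permutation code for $L$ parallel channels consists of $N^2\ge 4$ messages and of $L$ bijections $m\mapsto x_l(m)$, $l=1,\dots,L$, from the messages onto the square $N^2$-point QAM constellation with mean energy $1$; put $R=\frac1L\log_2 N^2$, so that there are $2^{LR}$ messages. Along a family of such codes indexed by $\eta\to\infty$, the permutations are required to satisfy the approximate universality criterion for parallel channels: for every $\varepsilon>0$ and all large $\eta$, $\prod_{l=1}^L|x_l(m)-x_l(m')|^2\ge \eta^{-\varepsilon}\,2^{-LR}$ for all messages $m\ne m'$. The rate levels $(R,2R,\dots,LR)$ have multiplexing gains $(r_n,2r_n,\dots,Lr_n)$ if $R/\log_2\eta\to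 r_n$. *Rateless scheme.* For a uniformly distributed message $m$ the symbols $x_1(m),x_2(m),\dots$ are sent one after the other. The receiver performs maximum likelihood decoding after the first block $l$ with $I_l\ge LR+\delta(\eta)$, and after block $L$ if this never happens; here $\delta(\eta)\ge 0$ is a back-off with $\delta(\eta)/\log_2\eta\to 0$. Let $p(l)=\Pr(I_l<LR+\delta(\eta))$, let $\bar R=LR/\sum_{l=0}^{L-1}p(l)$ be the average transmission rate, and let $P_e=\sum_{l=1}^{L}\Pr(\text{decoding takes place after block } l \text{ and is wrong})$. The effective multiplexing gain and the diversity order are $r=\lim_{\eta\to\infty}\bar R/\log_2\eta$ and $d=-\lim_{\eta\to\infty}\log_2 P_e/\log_2\eta$. *Claim.* Families of permutation codes as above, satisfying the criterion and with $R/\log_2\eta\to r_n$, exist. For every such family there is a back-off $\delta(\eta)\ge 0$, $\delta(\eta)=o(\log\eta)$, such that the limits defining $r$ and $d$ exist in the following cases and have the following values. If $\frac{l-1}{L}\le r_n<\frac{l}{L}$ for some $l\in\{1,\dots,L\}$, then $$r=r_n\cdot\frac{L}{l},\qquad d=f\!\left(\frac{l\,r}{L}\right),\qquad f(x)=1-x\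 \ (0\le x\le 1),$$ and if $r_n\ge 1$, then $d=0$. -/

import Mathlib

open MeasureTheory ProbabilityTheory Filter Topology

noncomputable section

namespace Rateless

/-! ### Channel -/

/-- The circularly symmetric complex Gaussian law with mean zero and unit variance. -/
def stdComplexGaussian : Measure ℂ :=
  ((gaussianReal 0 (1 / 2)).prod (gaussianReal 0 (1 / 2))).map
    (fun p : ℝ × ℝ => (⟨p.1, p.2⟩ : ℂ))

/-- Joint law of the fading coefficient `h`, which is constant during all `L` blocks, and of the
noise variables `n₁, …, n_L` (one channel use per block): all are independent, with the
standard complex Gaussian law. -/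
def channelLaw (L : ℕ) : Measure (ℂ × (Fin L → ℂ)) :=
  stdComplexGaussian.prod (Measure.pi fun _ => stdComplexGaussian)

/-- Total mutual information (in bits) between transmitter and receiver after `l` blocks of one
channel use each, at SNR `η` and fading coefficient `h`. -/
def mutualInfo (η : ℝ) (h : ℂ) (l : ℕ) : ℝ :=
  l * Real.logb 2 (1 + η * ‖h‖ ^ 2)

/-! ### Permutation codes -/

/-- The points of the square QAM constellation with `N ^ 2` points, centred at `0` and scaled to
average energy `1` (for `2 ≤ N`). -/
def qam (N : ℕ) (p : Fin N × Fin N) : ℂ :=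
  (Real.sqrt (3 / (2 * ((N : ℝ) ^ 2 - 1))) : ℂ) *
    ((2 * (p.1 : ℕ) - ((N : ℂ) - 1)) + (2 * (p.2 : ℕ) - ((N : ℂ) - 1)) * Complex.I)

/-- A unit-length QAM permutation code for `L` parallel scalar subchannels. There are `side ^ 2`
messages, labelled by the points of a QAM constellation with `side ^ 2` points; on each
subchannel the message is mapped to a point of the same constellation by a permutation. -/
structure PermCode (L : ℕ) where
  side : ℕ
  two_le_side : 2 ≤ side
  perm : Fin L → Equiv.Perm (Fin side × Fin side)

namespace PermCode

variable {L : ℕ}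

/-- The symbol `x_l(m)` sent on subchannel `l` of the parallel channel, that is, in block `l`
of the rateless channel, for the message `m`. -/
def symbol (c : PermCode L) (l : Fin L) (m : Fin c.side × Fin c.side) : ℂ :=
  qam c.side (c.perm l m)

/-- The lowest rate level `R`, in bits per channel use: the codebook has `2 ^ (L * R)` messages. -/
def rate (c : PermCode L) : ℝ := Real.logb 2 ((c.side : ℝ) ^ 2) / L

end PermCode

/-- The approximate universality criterion of permutation codes for parallel channels, for a
family of codes indexed by the SNR `η`: the product of the squared differences of any two
codewords is, to exponential order in `η`, at least `2 ^ (- L R)`. -/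
def ApproxUniversal {L : ℕ} (C : ℝ → PermCode L) : Prop :=
  ∀ ε : ℝ, 0 < ε → ∀ᶠ η in atTop, ∀ m m' : Fin (C η).side × Fin (C η).side, m ≠ m' →
    η ^ (-ε) * (2 : ℝ) ^ (-(L * (C η).rate)) ≤
      ∏ l : Fin L, ‖(C η).symbol l m - (C η).symbol l m'‖ ^ 2

/-- The rate levels `R, 2 R, …, L R` of the family have multiplexing gains
`rn, 2 rn, …, L rn`. -/
def HasMultiplexingGain {L : ℕ} (C : ℝ → PermCode L) (rn : ℝ) : Prop :=
  Tendsto (fun η => (C η).rate / Real.logb 2 η) atTop (𝓝 rn)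

/-! ### The rateless scheme

The symbols `x₁(m), …, x_L(m)` are sent one after the other, and the received values are
`y_i = √η h x_i(m) + n_i`. The receiver decodes after the first block at which the total mutual
information reaches `θ`, and after block `L` at the latest. -/

/-- Decoding takes place after block `l`. -/
def DecodesAt (L : ℕ) (η θ : ℝ) (h : ℂ) (l : ℕ) : Prop :=
  (∀ k : ℕ, 1 ≤ k → k < l → mutualInfo η h k < θ) ∧ (θ ≤ mutualInfo η h l ∨ l = L)

/-- The value received in block `i` when the message is `m`. -/
def received {L : ℕ} (c : PermCode L) (η : ℝ) (h : ℂ) (n : Fin L → ℂ)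
    (m : Fin c.side × Fin c.side) (i : Fin L) : ℂ :=
  (Real.sqrt η : ℂ) * h * c.symbol i m + n i

/-- Squared distance between the values received in the first `l` blocks, when `m` is sent, and
the noiseless values for the message `m'`. -/
def metric {L : ℕ} (c : PermCode L) (η : ℝ) (h : ℂ) (n : Fin L → ℂ)
    (m m' : Fin c.side × Fin c.side) (l : ℕ) : ℝ :=
  ∑ i : Fin L with i.val < l,
    ‖received c η h n m i - (Real.sqrt η : ℂ) * h * c.symbol i m'‖ ^ 2

/-- Maximum likelihood decoding from the first `l` blocks fails for the message `m` (a tie, which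
for `1 ≤ l` and `0 < η` has probability zero, counts as a failure). -/
def DecodingError {L : ℕ} (c : PermCode L) (η : ℝ) (h : ℂ) (n : Fin L → ℂ)
    (m : Fin c.side × Fin c.side) (l : ℕ) : Prop :=
  ∃ m', m' ≠ m ∧ metric c η h n m m' l ≤ metric c η h n m m l

/-- Overall error probability for a uniformly distributed message: the sum over `l = 1, …, L` of
the probability that decoding takes place after block `l` and is wrong. -/
def errorProb {L : ℕ} (c : PermCode L) (η θ : ℝ) : ℝ :=
  ∑ l ∈ Finset.Icc 1 L, (1 / (c.side : ℝ) ^ 2) * ∑ m : Fin c.side × Fin c.side,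
    (channelLaw L).real {ω | DecodesAt L η θ ω.1 l ∧ DecodingError c η ω.1 ω.2 m l}

/-- The probability `p(l)` that the total mutual information is below `θ` after block `l`. -/
def notReached (L : ℕ) (η θ : ℝ) (l : ℕ) : ℝ :=
  (channelLaw L).real {ω | mutualInfo η ω.1 l < θ}

/-- The average transmission rate `L R / ∑_{l < L} p(l)`, in bits per channel use. -/
def avgRate {L : ℕ} (c : PermCode L) (η θ : ℝ) : ℝ :=
  L * c.rate / ∑ l ∈ Finset.range L, notReached L η θ l

/-! ### Diversity-multiplexing tradeoff -/

/-- The effective multiplexing gain of a family with average rates `Rbar η` is `r`. -/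
def HasEffectiveGain (Rbar : ℝ → ℝ) (r : ℝ) : Prop :=
  Tendsto (fun η => Rbar η / Real.logb 2 η) atTop (𝓝 r)

/-- The diversity order of a family with error probabilities `Pe η` is `d`. -/
def HasDiversity (Pe : ℝ → ℝ) (d : ℝ) : Prop :=
  (∀ᶠ η in atTop, 0 < Pe η) ∧
    Tendsto (fun η => -(Real.logb 2 (Pe η) / Real.logb 2 η)) atTop (𝓝 d)

/-- The piecewise linear function through the points `(k, (M - k) (N - k))` for
`k = 0, …, min M N`, to be evaluated on `[0, min M N]`. -/
def dmtCurve (M N : ℕ) (x : ℝ) : ℝ :=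
  let g : ℝ → ℝ := fun k => (M - k) * (N - k)
  g ⌊x⌋ + (x - ⌊x⌋) * (g (⌊x⌋ + 1) - g ⌊x⌋)

end Rateless

end

/-!
**Why the result holds.** Write `Λ = logb 2 η` and `N ^ 2 = 2 ^ (L * R)` for the number of messages.

*Existence of codes.* Take `N` to be a prime near `η ^ (L * rn / 2)` and multiply both coordinates
of the message by units `α l` modulo `N` on subchannel `l`. The multipliers depend on the block but
the code is additive, so a pair of messages matters only through its difference, and averaging
over `α` the sum over all differences of the inverse product distance gives a choice for which every
product distance is optimal up to a power of `log N` (`exists_multipliers`,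
`exists_permCode_prime`). That power is absorbed by `η ^ ε`.

*Upper bound for the error.* If the mutual information of the first `l` blocks has reached
`L * R + δ`, the product distance criterion and the boundedness of the constellation force all
received codewords to be at squared distance at least a constant times `2 ^ (τ / L)`, where
`τ = √Λ` is the part of the back-off `δ` that is left after paying for the imperfection of the code
(`productDeficit`). An error then needs a noise value of that size (`exists_noise_large`), which has
probability `O(1 / η)`. What remains is the event that the threshold is never reached, of
probability at most `2 ^ (R + δ / L) / η`, that is, of order `η ^ (rn - 1)`.

*Lower bound for the error.* If `η * ‖h‖ ^ 2` is a small multiple of `2 ^ R`, all output densities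
are dominated by a multiple, less than half the number of messages, of one Gaussian probability
density, so correct decoding has average probability at most `1 / 2` (`sum_measure_correct_le`,
`half_le_sum_decodingError`). This event has probability of order `min 1 (2 ^ R / η)`.

*Effective gain.* The probability of missing the threshold after `k` blocks tends to `1` for
`k ≤ L * rn` and to `0` for `k > L * rn`. In the boundary case `k = L * rn` the limit is `1` because
the back-off dominates the deviation of `R` from `rn * Λ` by `√Λ` (`le_threshold`).
-/

namespace Rateless

/-! ### The complex Gaussian law -/

/-- The density of the circularly symmetric complex Gaussian law with mean zero and variance `v`. -/
noncomputable def complexGaussianPDF (v : ℝ) (z : ℂ) : ENNReal :=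
  ENNReal.ofReal ((Real.pi * v)⁻¹ * Real.exp (-(‖z‖ ^ 2 / v)))

lemma measurable_complexGaussianPDF (v : ℝ) : Measurable (complexGaussianPDF v) := by
  unfold complexGaussianPDF; fun_prop

lemma lintegral_complexGaussianPDF {v : ℝ} (hv : 0 < v) : ∫⁻ z, complexGaussianPDF v z = 1 := by
  have h := GaussianFourier.integral_rexp_neg_mul_sq_norm (V := ℂ) (inv_pos.2 hv)
  have h0 : (2 : ℝ) / 2 = 1 := by norm_num
  rw [Complex.finrank_real_complex, Nat.cast_ofNat, h0, Real.rpow_one, div_inv_eq_mul] at h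
  have hpos : 0 < Real.pi * v := by positivity
  have hint : Integrable (fun z : ℂ => Real.exp (-v⁻¹ * ‖z‖ ^ 2)) :=
    Integrable.of_integral_ne_zero (by rw [h]; exact hpos.ne')
  unfold complexGaussianPDF
  have he : ∀ z : ℂ, (Real.pi * v)⁻¹ * Real.exp (-(‖z‖ ^ 2 / v)) =
      (Real.pi * v)⁻¹ * Real.exp (-v⁻¹ * ‖z‖ ^ 2) := fun z => by
    congr 2; rw [div_eq_inv_mul, neg_mul]
  simp_rw [he]
  rw [← ofReal_integral_eq_lintegral_ofReal (hint.const_mul _)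
    (Eventually.of_forall fun z => by positivity), integral_const_mul, h,
    inv_mul_cancel₀ hpos.ne', ENNReal.ofReal_one]

lemma stdComplexGaussian_eq_withDensity :
    stdComplexGaussian = volume.withDensity (complexGaussianPDF 1) := by
  have hv : (1 / 2 : NNReal) ≠ 0 := by norm_num
  have hpdf : ∀ p : ℝ × ℝ, gaussianPDF 0 (1 / 2) p.1 * gaussianPDF 0 (1 / 2) p.2 =
      complexGaussianPDF 1 (Complex.measurableEquivRealProd.symm p) := fun p => by
    rw [gaussianPDF, gaussianPDF, ← ENNReal.ofReal_mul (gaussianPDFReal_nonneg _ _ _),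
      complexGaussianPDF, gaussianPDFReal, gaussianPDFReal]
    congr 1
    have h2 : (2 * Real.pi * ((1 / 2 : NNReal) : ℝ)) = Real.pi := by push_cast; ring
    rw [h2, mul_mul_mul_comm, ← mul_inv, Real.mul_self_sqrt Real.pi_pos.le, ← Real.exp_add, mul_one,
      Complex.sq_norm, Complex.normSq_apply, Complex.measurableEquivRealProd_symm_apply]
    congr 2
    push_cast
    ring
  unfold stdComplexGaussian
  rw [gaussianReal_of_var_ne_zero _ hv, prod_withDensity (measurable_gaussianPDF _ _)
    (measurable_gaussianPDF _ _)]
  simp_rw [hpdf]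
  have hmap : (fun p : ℝ × ℝ => (⟨p.1, p.2⟩ : ℂ)) = Complex.measurableEquivRealProd.symm := by
    funext p; rfl
  rw [hmap]
  ext s hs
  have hmp := Complex.volume_preserving_equiv_real_prod.symm
  rw [Measure.map_apply (MeasurableEquiv.measurable _) hs, withDensity_apply _ hs,
    withDensity_apply _ ((MeasurableEquiv.measurable _) hs), ← Measure.volume_eq_prod,
    hmp.setLIntegral_comp_preimage hs (measurable_complexGaussianPDF 1)]

instance : IsProbabilityMeasure stdComplexGaussian :=
  ⟨by rw [stdComplexGaussian_eq_withDensity, withDensity_apply _ MeasurableSet.univ,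
    Measure.restrict_univ, lintegral_complexGaussianPDF one_pos]⟩

instance (L : ℕ) : IsProbabilityMeasure (channelLaw L) := by
  unfold channelLaw; infer_instance

lemma setOf_norm_sq_lt_eq_ball (x : ℝ) :
    {z : ℂ | ‖z‖ ^ 2 < x} = Metric.ball 0 (Real.sqrt x) := by
  ext z
  simp [Real.lt_sqrt (norm_nonneg z)]

lemma volume_norm_sq_lt {x : ℝ} (hx : 0 ≤ x) :
    volume {z : ℂ | ‖z‖ ^ 2 < x} = ENNReal.ofReal (x * Real.pi) := by
  rw [setOf_norm_sq_lt_eq_ball x, Complex.volume_ball, ← ENNReal.ofReal_pow (Real.sqrt_nonneg _),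
    Real.sq_sqrt hx, ENNReal.ofReal_mul hx, ← NNReal.coe_real_pi, ENNReal.ofReal_coe_nnreal]

lemma measurableSet_norm_sq_lt (x : ℝ) : MeasurableSet {z : ℂ | ‖z‖ ^ 2 < x} :=
  measurableSet_lt (by fun_prop) measurable_const

lemma stdComplexGaussian_norm_sq_lt_le {x : ℝ} (hx : 0 ≤ x) :
    stdComplexGaussian.real {z | ‖z‖ ^ 2 < x} ≤ x := by
  refine ENNReal.toReal_le_of_le_ofReal hx ?_
  rw [stdComplexGaussian_eq_withDensity, withDensity_apply _ (measurableSet_norm_sq_lt x)]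
  calc ∫⁻ z in {z : ℂ | ‖z‖ ^ 2 < x}, complexGaussianPDF 1 z
      ≤ ∫⁻ _ in {z : ℂ | ‖z‖ ^ 2 < x}, ENNReal.ofReal Real.pi⁻¹ := by
        refine lintegral_mono fun z => ENNReal.ofReal_le_ofReal ?_
        rw [mul_one, div_one]
        exact mul_le_of_le_one_right (by positivity)
          (Real.exp_le_one_iff.2 (neg_nonpos.2 (sq_nonneg _)))
    _ = ENNReal.ofReal x := by
        rw [setLIntegral_const, volume_norm_sq_lt hx, ← ENNReal.ofReal_mul (by positivity)]
        congr 1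
        field_simp

lemma le_stdComplexGaussian_norm_sq_lt {x : ℝ} (hx : 0 ≤ x) :
    Real.exp (-1) * min 1 x ≤ stdComplexGaussian.real {z | ‖z‖ ^ 2 < x} := by
  set y := min 1 x with hy
  have hy0 : 0 ≤ y := le_min zero_le_one hx
  have hsub : {z : ℂ | ‖z‖ ^ 2 < y} ⊆ {z | ‖z‖ ^ 2 < x} := fun z hz =>
    show ‖z‖ ^ 2 < x from lt_of_lt_of_le hz (min_le_right _ _)
  refine le_trans ?_ (measureReal_mono hsub)
  rw [Measure.real, ← ENNReal.ofReal_le_iff_le_toReal (measure_ne_top _ _),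
    stdComplexGaussian_eq_withDensity, withDensity_apply _ (measurableSet_norm_sq_lt y)]
  calc ENNReal.ofReal (Real.exp (-1) * y)
      = ∫⁻ _ in {z : ℂ | ‖z‖ ^ 2 < y}, ENNReal.ofReal (Real.pi⁻¹ * Real.exp (-1)) := by
        rw [setLIntegral_const, volume_norm_sq_lt hy0, ← ENNReal.ofReal_mul (by positivity)]
        congr 1
        field_simp
    _ ≤ ∫⁻ z in {z : ℂ | ‖z‖ ^ 2 < y}, complexGaussianPDF 1 z := by
        refine setLIntegral_mono (measurable_complexGaussianPDF 1) fun z hz =>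
          ENNReal.ofReal_le_ofReal ?_
        have : ‖z‖ ^ 2 ≤ 1 := (le_of_lt hz).trans (min_le_left _ _)
        rw [mul_one, div_one]
        gcongr

lemma stdComplexGaussian_tail (t : ℝ) :
    stdComplexGaussian.real {z | t ≤ ‖z‖ ^ 2} ≤ 2 * Real.exp (-(t / 2)) := by
  have hm : MeasurableSet {z : ℂ | t ≤ ‖z‖ ^ 2} := measurableSet_le measurable_const (by fun_prop)
  refine ENNReal.toReal_le_of_le_ofReal (by positivity) ?_
  rw [stdComplexGaussian_eq_withDensity, withDensity_apply _ hm]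
  calc ∫⁻ z in {z : ℂ | t ≤ ‖z‖ ^ 2}, complexGaussianPDF 1 z
      ≤ ∫⁻ z in {z : ℂ | t ≤ ‖z‖ ^ 2},
          ENNReal.ofReal (2 * Real.exp (-(t / 2))) * complexGaussianPDF 2 z := by
        refine setLIntegral_mono ((measurable_complexGaussianPDF 2).const_mul _) fun z hz => ?_
        rw [complexGaussianPDF, complexGaussianPDF, ← ENNReal.ofReal_mul (by positivity)]
        refine ENNReal.ofReal_le_ofReal ?_
        have hz' : t ≤ ‖z‖ ^ 2 := hz
        calc (Real.pi * 1)⁻¹ * Real.exp (-(‖z‖ ^ 2 / 1))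
            ≤ Real.pi⁻¹ * Real.exp (-(t / 2) + -(‖z‖ ^ 2 / 2)) := by
              rw [mul_one, div_one]; gcongr; linarith
          _ = _ := by rw [Real.exp_add]; field_simp
    _ ≤ ∫⁻ z, ENNReal.ofReal (2 * Real.exp (-(t / 2))) * complexGaussianPDF 2 z :=
        setLIntegral_le_lintegral _ _
    _ = _ := by
        rw [lintegral_const_mul _ (measurable_complexGaussianPDF 2),
          lintegral_complexGaussianPDF two_pos, mul_one]

/-- The density of a shifted standard Gaussian is dominated, up to a constant, by the density of a
centred one of larger variance. -/
lemma complexGaussianPDF_sub_le {t B : ℝ} (ht : 0 < t) {s : ℂ} (hs : ‖s‖ ^ 2 ≤ B * t) (y : ℂ) :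
    complexGaussianPDF 1 (y - s) ≤
      ENNReal.ofReal ((1 + t) * Real.exp B) * complexGaussianPDF (1 + t) y := by
  rw [complexGaussianPDF, complexGaussianPDF, ← ENNReal.ofReal_mul (by positivity)]
  refine ENNReal.ofReal_le_ofReal ?_
  have h1 : ‖y‖ ≤ ‖y - s‖ + ‖s‖ := by simpa using norm_add_le (y - s) s
  -- Young's inequality `‖y‖² ≤ (1 + t) ‖y - s‖² + (1 + 1 / t) ‖s‖²`
  have h2 : ‖y‖ ^ 2 * t ≤ ((1 + t) * ‖y - s‖ ^ 2) * t + (1 + t) * ‖s‖ ^ 2 := by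
    have h3 : ‖y‖ ^ 2 ≤ (‖y - s‖ + ‖s‖) ^ 2 := by gcongr
    nlinarith [sq_nonneg (t * ‖y - s‖ - ‖s‖)]
  have h4 : ‖y‖ ^ 2 / (1 + t) ≤ ‖y - s‖ ^ 2 + B := by
    rw [div_le_iff₀ (by positivity)]
    refine le_of_mul_le_mul_right (h2.trans ?_) ht
    nlinarith
  calc (Real.pi * 1)⁻¹ * Real.exp (-(‖y - s‖ ^ 2 / 1))
      ≤ Real.pi⁻¹ * Real.exp (B + -(‖y‖ ^ 2 / (1 + t))) := by
        rw [mul_one, div_one]; gcongr; linarith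
    _ = _ := by rw [Real.exp_add]; field_simp

/-! ### Finite products of densities -/

lemma lintegral_fin_prod_eq_prod {n : ℕ} {E : Type*} [MeasurableSpace E] (μ : Measure E)
    [SigmaFinite μ] (f : Fin n → E → ENNReal) (hf : ∀ i, Measurable (f i)) :
    ∫⁻ x : Fin n → E, ∏ i, f i (x i) ∂(Measure.pi fun _ => μ) = ∏ i, ∫⁻ x, f i x ∂μ := by
  induction n with
  | zero => simp
  | succ n ih =>
    have hmp := (measurePreserving_piFinSuccAbove (fun _ : Fin (n + 1) => μ) 0).symm
    rw [← hmp.lintegral_comp_emb (MeasurableEquiv.measurableEmbedding _)]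
    simp_rw [MeasurableEquiv.piFinSuccAbove_symm_apply, Fin.insertNthEquiv, Fin.prod_univ_succ,
      Equiv.coe_fn_mk, Fin.insertNth_zero, Fin.cons_zero, Fin.cons_succ, cast_eq]
    have hm : Measurable fun y : Fin n → E => ∏ i, f i.succ (y i) :=
      Finset.measurable_prod _ fun i _ => (hf _).comp (measurable_pi_apply i)
    rw [lintegral_prod_mul (hf 0).aemeasurable hm.aemeasurable, ih _ fun i => hf _]

lemma pi_withDensity {n : ℕ} {E : Type*} [MeasurableSpace E] (μ : Measure E) [SigmaFinite μ]
    (f : E → ENNReal) (hf : Measurable f) [SigmaFinite (μ.withDensity f)] :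
    Measure.pi (fun _ : Fin n => μ.withDensity f) =
      (Measure.pi fun _ => μ).withDensity fun x => ∏ i, f (x i) := by
  refine Measure.pi_eq fun s hs => ?_
  rw [withDensity_apply _ (MeasurableSet.univ_pi hs),
    ← lintegral_indicator (MeasurableSet.univ_pi hs)]
  have h : ∀ x : Fin n → E, (Set.univ.pi s).indicator (fun x => ∏ i, f (x i)) x =
      ∏ i, (s i).indicator f (x i) := fun x => by
    by_cases hx : x ∈ Set.univ.pi s
    · rw [Set.indicator_of_mem hx]
      exact Finset.prod_congr rfl fun i _ => (Set.indicator_of_mem (hx i trivial) f).symm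
    · rw [Set.indicator_of_notMem hx]
      have : ∃ i, x i ∉ s i := by simpa [Set.mem_pi] using hx
      obtain ⟨i, hi⟩ := this
      exact (Finset.prod_eq_zero (Finset.mem_univ i) (Set.indicator_of_notMem hi f)).symm
  simp_rw [h]
  rw [lintegral_fin_prod_eq_prod μ _ fun i => hf.indicator (hs i)]
  exact Finset.prod_congr rfl fun i _ => by
    rw [lintegral_indicator (hs i), withDensity_apply _ (hs i)]

/-- A form of the converse of the channel coding theorem for the Gaussian channel: if the codewords
`s m` have small energy, the probabilities of correct decoding cannot have a large sum, because
all output densities are dominated by a multiple of one probability density. -/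
lemma sum_measure_correct_le {L : ℕ} {ι : Type*} [Fintype ι] (s : ι → Fin L → ℂ)
    (D : ι → Set (Fin L → ℂ)) (hD : ∀ m, MeasurableSet (D m))
    (hdisj : Pairwise (Function.onFun Disjoint D)) {t B : ℝ} (ht : 0 < t)
    (hs : ∀ m i, ‖s m i‖ ^ 2 ≤ B * t) :
    ∑ m, (Measure.pi fun _ : Fin L => stdComplexGaussian) {n | s m + n ∈ D m} ≤
      ENNReal.ofReal (((1 + t) * Real.exp B) ^ L) := by
  have hmeas : ∀ v, Measurable fun y : Fin L → ℂ => ∏ i, complexGaussianPDF v (y i) := fun v =>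
    Finset.measurable_prod _ fun i _ =>
      (measurable_complexGaussianPDF v).comp (measurable_pi_apply i)
  have hstd : SigmaFinite (volume.withDensity (complexGaussianPDF 1)) := by
    rw [← stdComplexGaussian_eq_withDensity]; infer_instance
  have hshift : ∀ m, MeasurableSet {n | s m + n ∈ D m} := fun m =>
    (measurable_const_add (s m)) (hD m)
  set K := ENNReal.ofReal (((1 + t) * Real.exp B) ^ L) with hK
  have hone : ∀ m, (Measure.pi fun _ : Fin L => stdComplexGaussian) {n | s m + n ∈ D m} ≤
      ∫⁻ y in D m, K * ∏ i, complexGaussianPDF (1 + t) (y i) := fun m => by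
    rw [stdComplexGaussian_eq_withDensity, pi_withDensity _ _ (measurable_complexGaussianPDF 1),
      withDensity_apply _ (hshift m), ← lintegral_indicator (hshift m), ← volume_pi,
      ← lintegral_indicator (hD m)]
    have hrw : ∀ n : Fin L → ℂ,
        ({n | s m + n ∈ D m}.indicator (fun n => ∏ i, complexGaussianPDF 1 (n i)) n) =
        (D m).indicator (fun y => ∏ i, complexGaussianPDF 1 (y i - s m i)) (s m + n) := fun n => by
      by_cases hn : s m + n ∈ D m
      · rw [Set.indicator_of_mem hn, Set.indicator_of_mem (show n ∈ {n | s m + n ∈ D m} from hn)]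
        simp
      · rw [Set.indicator_of_notMem hn,
          Set.indicator_of_notMem (show n ∉ {n | s m + n ∈ D m} from hn)]
    simp_rw [hrw]
    rw [lintegral_add_left_eq_self
      (fun y => (D m).indicator (fun y => ∏ i, complexGaussianPDF 1 (y i - s m i)) y) (s m)]
    refine lintegral_mono fun y => Set.indicator_le_indicator ?_
    calc ∏ i, complexGaussianPDF 1 (y i - s m i)
        ≤ ∏ i : Fin L, ENNReal.ofReal ((1 + t) * Real.exp B) * complexGaussianPDF (1 + t) (y i) :=
          Finset.prod_le_prod' fun i _ => complexGaussianPDF_sub_le ht (hs m i) (y i)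
      _ = _ := by
          rw [Finset.prod_mul_distrib, Finset.prod_const, Finset.card_univ, Fintype.card_fin,
            ← ENNReal.ofReal_pow (by positivity)]
  calc ∑ m, (Measure.pi fun _ : Fin L => stdComplexGaussian) {n | s m + n ∈ D m}
      ≤ ∑ m, ∫⁻ y in D m, K * ∏ i, complexGaussianPDF (1 + t) (y i) :=
        Finset.sum_le_sum fun m _ => hone m
    _ = ∫⁻ y in ⋃ m, D m, K * ∏ i, complexGaussianPDF (1 + t) (y i) := by
        rw [lintegral_iUnion hD hdisj, tsum_fintype]
    _ ≤ ∫⁻ y : Fin L → ℂ, K * ∏ i, complexGaussianPDF (1 + t) (y i) :=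
        setLIntegral_le_lintegral _ _
    _ = K := by
        rw [lintegral_const_mul _ (hmeas _), volume_pi, lintegral_fin_prod_eq_prod _ _
          fun _ => measurable_complexGaussianPDF _]
        simp [lintegral_complexGaussianPDF (show 0 < 1 + t by linarith)]

/-! ### Approximately universal permutation codes -/

/-- The weight of a residue class, a bound for the inverse of its distance to the multiples
of `p`. -/
noncomputable def residueWeight {p : ℕ} (c : ZMod p) : ℝ :=
  ((c.val : ℝ))⁻¹ + (((-c).val : ℝ))⁻¹

lemma residueWeight_nonneg {p : ℕ} (c : ZMod p) : 0 ≤ residueWeight c := by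
  unfold residueWeight; positivity

lemma sum_units_residueWeight_le (p : ℕ) [Fact p.Prime] :
    ∑ u : (ZMod p)ˣ, residueWeight (u : ZMod p) ≤ 2 * (1 + Real.log p) := by
  have hneg : ∑ u : (ZMod p)ˣ, ((((-u : (ZMod p)ˣ) : ZMod p).val : ℝ))⁻¹ =
      ∑ u : (ZMod p)ˣ, (((u : ZMod p).val : ℝ))⁻¹ :=
    Equiv.sum_comp (Equiv.neg (ZMod p)ˣ) fun u => (((u : ZMod p).val : ℝ))⁻¹
  have hle : ∑ u : (ZMod p)ˣ, (((u : ZMod p).val : ℝ))⁻¹ ≤ 1 + Real.log p := by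
    have hinj : Set.InjOn (fun u : (ZMod p)ˣ => (u : ZMod p).val)
        (Finset.univ : Finset (ZMod p)ˣ) := fun u _ v _ h =>
      Units.ext (ZMod.val_injective p h)
    rw [← Finset.sum_image (f := fun k : ℕ => ((k : ℝ))⁻¹) hinj]
    calc _ ≤ ∑ k ∈ Finset.Icc 1 p, ((k : ℝ))⁻¹ := by
          refine Finset.sum_le_sum_of_subset_of_nonneg ?_ fun _ _ _ => by positivity
          intro k hk
          obtain ⟨u, -, rfl⟩ := Finset.mem_image.1 hk
          refine Finset.mem_Icc.2 ⟨Nat.one_le_iff_ne_zero.2 ?_, (ZMod.val_lt _).le⟩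
          exact (ZMod.val_ne_zero _).2 u.ne_zero
      _ ≤ 1 + Real.log p := by
          have := harmonic_le_one_add_log p
          rw [harmonic_eq_sum_Icc] at this
          push_cast at this
          exact this
  have hsplit : ∑ u : (ZMod p)ˣ, residueWeight (u : ZMod p) =
      ∑ u : (ZMod p)ˣ, (((u : ZMod p).val : ℝ))⁻¹ +
        ∑ u : (ZMod p)ˣ, ((((-u : (ZMod p)ˣ) : ZMod p).val : ℝ))⁻¹ := by
    rw [← Finset.sum_add_distrib]
    simp [residueWeight]
  rw [hsplit, hneg]
  linarith

/-- Averaging over all tuples of multipliers: some tuple keeps every nonzero class away from zero in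
the sense of products, as good lattice points do. -/
lemma exists_multipliers (L p : ℕ) [Fact p.Prime] :
    ∃ α : Fin L → (ZMod p)ˣ, ∀ c : (ZMod p)ˣ,
      ((p : ℝ) - 1) ^ L * ∏ l, residueWeight ((α l : ZMod p) * (c : ZMod p)) ≤
        (p - 1) * (2 * (1 + Real.log p)) ^ L := by
  have hp : 1 ≤ p := (Fact.out : p.Prime).one_lt.le
  set S := ∑ u : (ZMod p)ˣ, residueWeight (u : ZMod p) with hS
  have hcard : (Fintype.card (ZMod p)ˣ : ℝ) = p - 1 := by
    rw [ZMod.card_units, Nat.cast_sub hp, Nat.cast_one]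
  have hS0 : 0 ≤ S := Finset.sum_nonneg fun _ _ => residueWeight_nonneg _
  have hshift : ∀ c : (ZMod p)ˣ, ∑ u : (ZMod p)ˣ, residueWeight ((u : ZMod p) * (c : ZMod p)) = S := fun c => by
    simpa using Equiv.sum_comp (Equiv.mulRight c) fun u : (ZMod p)ˣ => residueWeight (u : ZMod p)
  have htot : ∀ c : (ZMod p)ˣ,
      ∑ α : Fin L → (ZMod p)ˣ, ∏ l, residueWeight ((α l : ZMod p) * (c : ZMod p)) = S ^ L := fun c => by
    have h := Finset.prod_univ_sum (fun _ : Fin L => (Finset.univ : Finset (ZMod p)ˣ))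
      fun _ u => residueWeight ((u : ZMod p) * (c : ZMod p))
    rw [Fintype.piFinset_univ] at h
    rw [← h]
    simp [hshift]
  obtain ⟨α, -, hα⟩ := Finset.exists_le_of_sum_le
    (s := (Finset.univ : Finset (Fin L → (ZMod p)ˣ)))
    (f := fun α => ((p : ℝ) - 1) ^ L *
      ∑ c : (ZMod p)ˣ, ∏ l, residueWeight ((α l : ZMod p) * (c : ZMod p)))
    (g := fun _ => (p - 1) * S ^ L) Finset.univ_nonempty (by
      rw [← Finset.mul_sum, Finset.sum_comm, Finset.sum_congr rfl fun c _ => htot c]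
      simp only [Finset.sum_const, Finset.card_univ, nsmul_eq_mul, Fintype.card_fun,
        Fintype.card_fin, Nat.cast_pow, hcard]
      exact le_rfl)
  have hp1 : (0 : ℝ) ≤ p - 1 := by rw [← hcard]; positivity
  refine ⟨α, fun c => le_trans ?_ (hα.trans ?_)⟩
  · refine mul_le_mul_of_nonneg_left ?_ (by positivity)
    exact Finset.single_le_sum (f := fun c : (ZMod p)ˣ => ∏ l, residueWeight ((α l : ZMod p) * (c : ZMod p)))
      (fun c _ => Finset.prod_nonneg fun _ _ => residueWeight_nonneg _) (Finset.mem_univ c)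
  · have := sum_units_residueWeight_le p
    gcongr

lemma one_le_abs_mul_residueWeight {p : ℕ} [NeZero p] {a b : ZMod p} (hab : a ≠ b) :
    1 ≤ |(a.val : ℝ) - b.val| * residueWeight (a - b) := by
  have key : ∀ {a b : ZMod p}, b.val < a.val → 1 ≤ ((a.val : ℝ) - b.val) * ((a - b).val : ℝ)⁻¹ := by
    intro a b h
    rw [ZMod.val_sub h.le, Nat.cast_sub h.le, mul_inv_cancel₀]
    have : (b.val : ℝ) < a.val := by exact_mod_cast h
    exact (sub_pos.2 this).ne'
  rcases lt_or_gt_of_ne (fun h => hab (ZMod.val_injective p h)) with h | h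
  · have h' : (a.val : ℝ) < b.val := by exact_mod_cast h
    rw [abs_of_neg (sub_neg.2 h'), neg_sub, residueWeight, neg_sub, mul_add]
    have := key h
    have h2 : 0 ≤ ((b.val : ℝ) - a.val) * ((a - b).val : ℝ)⁻¹ :=
      mul_nonneg (by linarith) (by positivity)
    linarith
  · have h' : (b.val : ℝ) < a.val := by exact_mod_cast h
    rw [abs_of_pos (sub_pos.2 h'), residueWeight, mul_add]
    have := key h
    have h2 : 0 ≤ ((a.val : ℝ) - b.val) * ((-(a - b)).val : ℝ)⁻¹ :=
      mul_nonneg (by linarith) (by positivity)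
    linarith

lemma norm_sq_qam_sub {N : ℕ} (hN : 2 ≤ N) (x y : Fin N × Fin N) :
    ‖qam N x - qam N y‖ ^ 2 = 6 / ((N : ℝ) ^ 2 - 1) *
      (((x.1 : ℝ) - (y.1 : ℝ)) ^ 2 + ((x.2 : ℝ) - (y.2 : ℝ)) ^ 2) := by
  have hN' : (2 : ℝ) ≤ N := by exact_mod_cast hN
  have hpos : (0 : ℝ) < (N : ℝ) ^ 2 - 1 := by nlinarith
  have h : qam N x - qam N y = ((Real.sqrt (3 / (2 * ((N : ℝ) ^ 2 - 1))) : ℝ) : ℂ) *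
      (⟨2 * ((x.1 : ℝ) - y.1), 2 * ((x.2 : ℝ) - y.2)⟩ : ℂ) := by
    unfold qam
    rw [← mul_sub]
    congr 1
    apply Complex.ext <;> simp <;> ring
  rw [h, norm_mul, mul_pow, Complex.norm_real, Real.norm_eq_abs, sq_abs,
    Real.sq_sqrt (by positivity), Complex.sq_norm, Complex.normSq_apply]
  field_simp
  ring

/-- Every point of the constellation has energy at most three times the mean energy. -/
lemma norm_sq_qam_le {N : ℕ} (hN : 2 ≤ N) (x : Fin N × Fin N) : ‖qam N x‖ ^ 2 ≤ 3 := by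
  have hN' : (2 : ℝ) ≤ N := by exact_mod_cast hN
  have hpos : (0 : ℝ) < (N : ℝ) ^ 2 - 1 := by nlinarith
  have h : qam N x = ((Real.sqrt (3 / (2 * ((N : ℝ) ^ 2 - 1))) : ℝ) : ℂ) *
      (⟨2 * (x.1 : ℝ) - (N - 1), 2 * (x.2 : ℝ) - (N - 1)⟩ : ℂ) := by
    unfold qam
    congr 1
    apply Complex.ext <;> simp
  have hb : ∀ i : Fin N, (2 * (i : ℝ) - (N - 1)) * (2 * (i : ℝ) - (N - 1)) ≤ ((N : ℝ) - 1) ^ 2 :=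
    fun i => by
      have h1 : (i : ℝ) + 1 ≤ N := by exact_mod_cast i.2
      have h0 : (0 : ℝ) ≤ i := by positivity
      nlinarith
  rw [h, norm_mul, mul_pow, Complex.norm_real, Real.norm_eq_abs, sq_abs,
    Real.sq_sqrt (by positivity), Complex.sq_norm, Complex.normSq_apply]
  have h1 := hb x.1
  have h2 := hb x.2
  rw [div_mul_eq_mul_div, div_le_iff₀ (by positivity)]
  nlinarith

namespace PermCode

lemma two_rpow_mul_rate {L : ℕ} (hL : 1 ≤ L) (c : PermCode L) :
    (2 : ℝ) ^ (L * c.rate) = (c.side : ℝ) ^ 2 := by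
  have hL' : (L : ℝ) ≠ 0 := by positivity
  have := c.two_le_side
  rw [rate, mul_div_cancel₀ _ hL', Real.rpow_logb two_pos (by norm_num) (by positivity)]

end PermCode

/-- The residue classes modulo `p`, labelled by their least nonnegative representatives. -/
def zmodEquivFin (p : ℕ) [NeZero p] : ZMod p ≃ Fin p where
  toFun c := ⟨c.val, ZMod.val_lt c⟩
  invFun i := (i : ℕ)
  left_inv c := ZMod.natCast_zmod_val c
  right_inv i := Fin.ext (ZMod.val_cast_of_lt i.2)

/-- The permutation code that multiplies, on subchannel `l`, both coordinates of the message by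
`α l` modulo `p`. -/
def multiplierCode {L p : ℕ} (hp : p.Prime) [NeZero p] (α : Fin L → (ZMod p)ˣ) : PermCode L where
  side := p
  two_le_side := hp.two_le
  perm l :=
    let σ : Equiv.Perm (Fin p) := (zmodEquivFin p).permCongr (Units.mulLeft (α l))
    σ.prodCongr σ

lemma exists_permCode_prime (L : ℕ) {p : ℕ} (hp : p.Prime) :
    ∃ c : PermCode L, c.side = p ∧ ∀ m m' : Fin c.side × Fin c.side, m ≠ m' →
      (p : ℝ) ^ (-2 : ℤ) * ((4 * (1 + Real.log p)) ^ (2 * L))⁻¹ ≤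
        ∏ l : Fin L, ‖c.symbol l m - c.symbol l m'‖ ^ 2 := by
  have : Fact p.Prime := ⟨hp⟩
  have : NeZero p := ⟨hp.ne_zero⟩
  obtain ⟨α, hα⟩ := exists_multipliers L p
  have hp2 : (2 : ℝ) ≤ p := by exact_mod_cast hp.two_le
  have hpos : (0 : ℝ) < (p : ℝ) ^ 2 - 1 := by nlinarith
  have hlog : 0 ≤ Real.log p := Real.log_natCast_nonneg p
  -- one coordinate of the message suffices
  have key : ∀ a b : Fin p, a ≠ b → (p : ℝ) ^ (-2 : ℤ) * ((4 * (1 + Real.log p)) ^ (2 * L))⁻¹ ≤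
      ∏ l : Fin L, (((p : ℝ) ^ 2)⁻¹ * ((((α l : ZMod p) * ((a : ℕ) : ZMod p)).val : ℝ) -
        ((α l : ZMod p) * ((b : ℕ) : ZMod p)).val) ^ 2) := by
    intro a b hab
    have hne : ((a : ℕ) : ZMod p) ≠ ((b : ℕ) : ZMod p) := fun h =>
      hab ((zmodEquivFin p).symm.injective h)
    obtain ⟨c, hc⟩ : IsUnit (((a : ℕ) : ZMod p) - ((b : ℕ) : ZMod p)) :=
      (sub_ne_zero.2 hne).isUnit
    set d : Fin L → ℝ := fun l => |(((α l : ZMod p) * ((a : ℕ) : ZMod p)).val : ℝ) -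
        ((α l : ZMod p) * ((b : ℕ) : ZMod p)).val| with hd
    set W := ∏ l, residueWeight ((α l : ZMod p) * (c : ZMod p)) with hW
    have hone : 1 ≤ (∏ l, d l) * W := by
      rw [hW, ← Finset.prod_mul_distrib]
      refine Finset.one_le_prod fun l _ => ?_
      rw [hc, mul_sub]
      exact one_le_abs_mul_residueWeight fun h => hne ((α l).isUnit.mul_left_cancel h)
    have hd0 : 0 ≤ ∏ l, d l := Finset.prod_nonneg fun _ _ => abs_nonneg _
    have hW0 : 0 ≤ W := Finset.prod_nonneg fun _ _ => residueWeight_nonneg _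
    set T := 2 * (1 + Real.log p) with hT
    have hT0 : 0 < T := by positivity
    -- the product of the coordinate differences is at least `(p / (2 T)) ^ L / p`
    have h1 : ((p : ℝ) / 2) ^ L ≤ (∏ l, d l) * (p * T ^ L) := by
      have h2 := hα c
      calc ((p : ℝ) / 2) ^ L ≤ ((p : ℝ) - 1) ^ L := by gcongr; linarith
        _ ≤ ((p : ℝ) - 1) ^ L * ((∏ l, d l) * W) :=
            le_mul_of_one_le_right (pow_nonneg (by linarith) _) hone
        _ = (∏ l, d l) * (((p : ℝ) - 1) ^ L * W) := by ring
        _ ≤ (∏ l, d l) * ((p - 1) * T ^ L) := by gcongr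
        _ ≤ _ := by gcongr; linarith
    have h3 : (p : ℝ) ^ L ≤ (∏ l, d l) * (p * (2 * T) ^ L) := by
      rw [div_pow, div_le_iff₀ (by positivity)] at h1
      calc (p : ℝ) ^ L ≤ _ := h1
        _ = _ := by rw [mul_pow 2 T]; ring
    have h4 : (4 * (1 + Real.log p)) = 2 * T := by rw [hT]; ring
    have h5 : ∏ l : Fin L, (((p : ℝ) ^ 2)⁻¹ * ((((α l : ZMod p) * ((a : ℕ) : ZMod p)).val : ℝ) -
        ((α l : ZMod p) * ((b : ℕ) : ZMod p)).val) ^ 2) =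
        (((p : ℝ) ^ L)⁻¹ * ∏ l, d l) ^ 2 := by
      rw [Finset.prod_mul_distrib, Finset.prod_const, Finset.card_univ, Fintype.card_fin, mul_pow,
        ← Finset.prod_pow]
      congr 1
      · rw [inv_pow, ← pow_mul, inv_pow, ← pow_mul, mul_comm]
      · exact Finset.prod_congr rfl fun l _ => (sq_abs _).symm
    have h6 : (p : ℝ) ^ (-2 : ℤ) * ((2 * T) ^ (2 * L))⁻¹ = ((p * (2 * T) ^ L)⁻¹) ^ 2 := by
      rw [zpow_neg, inv_pow, mul_pow (p : ℝ), ← pow_mul, mul_inv, mul_comm L 2]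
      rfl
    rw [h5, h4, h6]
    refine pow_le_pow_left₀ (by positivity) ?_ 2
    rw [inv_le_iff_one_le_mul₀ (by positivity)]
    calc (1 : ℝ) = ((p : ℝ) ^ L)⁻¹ * (p : ℝ) ^ L := by
          rw [inv_mul_cancel₀ (by positivity)]
      _ ≤ ((p : ℝ) ^ L)⁻¹ * ((∏ l, d l) * (p * (2 * T) ^ L)) := by gcongr
      _ = _ := by ring
  refine ⟨multiplierCode hp α, rfl, fun m m' hmm => ?_⟩
  have hscale : ((p : ℝ) ^ 2)⁻¹ ≤ 6 / ((p : ℝ) ^ 2 - 1) := by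
    rw [inv_eq_one_div]
    exact div_le_div₀ (by norm_num) (by norm_num) hpos (by linarith)
  have hsym : ∀ l, ‖(multiplierCode hp α).symbol l m - (multiplierCode hp α).symbol l m'‖ ^ 2 =
      6 / ((p : ℝ) ^ 2 - 1) *
      (((((α l : ZMod p) * ((m.1 : ℕ) : ZMod p)).val : ℝ) -
        ((α l : ZMod p) * ((m'.1 : ℕ) : ZMod p)).val) ^ 2 +
      ((((α l : ZMod p) * ((m.2 : ℕ) : ZMod p)).val : ℝ) -
        ((α l : ZMod p) * ((m'.2 : ℕ) : ZMod p)).val) ^ 2) := fun l =>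
    norm_sq_qam_sub hp.two_le _ _
  by_cases h1 : m.1 = m'.1
  · have h2 : m.2 ≠ m'.2 := fun h => hmm (Prod.ext h1 h)
    refine (key _ _ h2).trans (Finset.prod_le_prod (fun _ _ => by positivity) fun l _ => ?_)
    rw [hsym l]
    exact mul_le_mul hscale (le_add_of_nonneg_left (sq_nonneg _)) (sq_nonneg _) (by positivity)
  · refine (key _ _ h1).trans (Finset.prod_le_prod (fun _ _ => by positivity) fun l _ => ?_)
    rw [hsym l]
    exact mul_le_mul hscale (le_add_of_nonneg_right (sq_nonneg _)) (sq_nonneg _) (by positivity)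

lemma tendsto_logb_two_atTop : Tendsto (Real.logb 2) atTop atTop :=
  Real.tendsto_logb_atTop one_lt_two

theorem exists_approxUniversal (L : ℕ) (hL : 1 ≤ L) (rn : ℝ) (hrn : 0 ≤ rn) :
    ∃ C : ℝ → PermCode L, ApproxUniversal C ∧ HasMultiplexingGain C rn := by
  have hL' : (0 : ℝ) < L := by positivity
  set a : ℝ := L * rn / 2 with ha
  have ha0 : 0 ≤ a := by positivity
  have hprime : ∀ η : ℝ, ∃ p : ℕ, p.Prime ∧ ⌈η ^ a⌉₊ + 1 < p ∧ p ≤ 2 * (⌈η ^ a⌉₊ + 1) := fun η =>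
    Nat.exists_prime_lt_and_le_two_mul _ (Nat.succ_ne_zero _)
  choose p hp hlt hle using hprime
  choose C hside hC using fun η => exists_permCode_prime L (hp η)
  have hlow : ∀ η : ℝ, η ^ a ≤ p η := fun η => by
    have h1 : ((⌈η ^ a⌉₊ + 1 : ℕ) : ℝ) < p η := by exact_mod_cast hlt η
    have h2 := Nat.le_ceil (η ^ a)
    push_cast at h1
    linarith
  have hup : ∀ η : ℝ, 1 ≤ η → (p η : ℝ) ≤ 6 * η ^ a := fun η hη => by
    have h1 : (p η : ℝ) ≤ ((2 * (⌈η ^ a⌉₊ + 1) : ℕ) : ℝ) := by exact_mod_cast hle η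
    have h0 : 1 ≤ η ^ a := Real.one_le_rpow hη ha0
    have h2 := Nat.ceil_lt_add_one (show 0 ≤ η ^ a by linarith)
    push_cast at h1
    linarith
  have hppos : ∀ η, (0 : ℝ) < p η := fun η => by exact_mod_cast (hp η).pos
  refine ⟨C, fun ε hε => ?_, ?_⟩
  · have hlogle : ∀ᶠ η : ℝ in atTop, 4 * (1 + (Real.log 6 + a * Real.log η)) ≤
        η ^ (ε / (2 * L)) := by
      have hs : 0 < ε / (2 * L) := by positivity
      have h1 : (fun η : ℝ => 4 * (1 + (Real.log 6 + a * Real.log η))) =o[atTop]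
          fun η : ℝ => η ^ (ε / (2 * L)) := by
        have hc : ∀ c : ℝ, (fun _ : ℝ => c) =o[atTop] fun η : ℝ => η ^ (ε / (2 * L)) := fun c =>
          Asymptotics.isLittleO_const_left.2 (Or.inr
            (tendsto_norm_atTop_atTop.comp (tendsto_rpow_atTop hs)))
        exact ((hc 1).add ((hc _).add ((isLittleO_log_rpow_atTop hs).const_mul_left a))).const_mul_left 4
      filter_upwards [h1.bound one_pos, eventually_ge_atTop 0] with η h hη
      rw [one_mul, Real.norm_eq_abs, Real.norm_eq_abs, abs_of_nonneg (Real.rpow_nonneg hη _)] at h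
      exact (le_abs_self _).trans h
    filter_upwards [hlogle, eventually_ge_atTop 1] with η hη h1 m m' hmm
    refine le_trans ?_ (hC η m m' hmm)
    have hη0 : 0 < η := by linarith
    have hlogp : Real.log (p η) ≤ Real.log 6 + a * Real.log η := by
      rw [← Real.log_rpow hη0, ← Real.log_mul (by norm_num) (by positivity)]
      exact Real.log_le_log (hppos η) (hup η h1)
    have hlog0 : 0 ≤ Real.log (p η) := Real.log_natCast_nonneg _
    rw [Real.rpow_neg two_pos.le, PermCode.two_rpow_mul_rate hL, hside, Real.rpow_neg hη0.le,
      mul_comm, zpow_neg]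
    refine mul_le_mul_of_nonneg_left (inv_anti₀ (by positivity) ?_) (by positivity)
    calc (4 * (1 + Real.log (p η))) ^ (2 * L) ≤ (η ^ (ε / (2 * L))) ^ (2 * L) := by
          refine pow_le_pow_left₀ (by positivity) (le_trans ?_ hη) _
          linarith
      _ = η ^ ε := by
          rw [← Real.rpow_mul_natCast hη0.le]
          congr 1
          push_cast
          field_simp
  · have hrate : ∀ η, (C η).rate = 2 * Real.logb 2 (p η) / L := fun η => by
      rw [PermCode.rate, hside, Real.logb_pow, Nat.cast_ofNat]
    have hΛ := tendsto_logb_two_atTop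
    have hlim : Tendsto (fun η => 2 * (Real.logb 2 6 / Real.logb 2 η + a) / L) atTop (𝓝 rn) := by
      have h := ((((tendsto_const_nhds (x := Real.logb 2 6)).div_atTop hΛ).add
        (tendsto_const_nhds (x := a))).const_mul 2).div_const (L : ℝ)
      convert h using 2
      rw [ha]; field_simp; ring
    refine tendsto_of_tendsto_of_tendsto_of_le_of_le' tendsto_const_nhds hlim ?_ ?_
    · filter_upwards [eventually_gt_atTop 1] with η hη
      have hη0 : 0 < η := by linarith
      have hpos : 0 < Real.logb 2 η := Real.logb_pos one_lt_two hη
      have h1 : a * Real.logb 2 η ≤ Real.logb 2 (p η) := by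
        rw [← Real.logb_rpow_eq_mul_logb_of_pos hη0]
        exact Real.logb_le_logb_of_le one_lt_two (by positivity) (hlow η)
      rw [hrate, le_div_iff₀ hpos, le_div_iff₀ hL']
      rw [ha] at h1
      linarith
    · filter_upwards [eventually_gt_atTop 1] with η hη
      have hη0 : 0 < η := by linarith
      have hpos : 0 < Real.logb 2 η := Real.logb_pos one_lt_two hη
      have h1 : Real.logb 2 (p η) ≤ Real.logb 2 6 + a * Real.logb 2 η := by
        rw [← Real.logb_rpow_eq_mul_logb_of_pos hη0, ← Real.logb_mul (by norm_num) (by positivity)]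
        exact Real.logb_le_logb_of_le one_lt_two (hppos η) (hup η hη.le)
      rw [hrate, div_div, mul_comm (L : ℝ), ← div_div]
      refine div_le_div_of_nonneg_right ?_ hL'.le
      rw [div_le_iff₀ hpos, mul_assoc, add_mul, div_mul_cancel₀ _ hpos.ne']
      linarith

/-! ### Events of the channel -/

lemma channelLaw_real_fst {L : ℕ} (s : Set ℂ) (hs : MeasurableSet s) :
    (channelLaw L).real {ω | ω.1 ∈ s} = stdComplexGaussian.real s := by
  have h : MeasurePreserving Prod.fst (channelLaw L) stdComplexGaussian :=
    measurePreserving_fst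
  exact h.measureReal_preimage hs.nullMeasurableSet

lemma channelLaw_real_noise_tail {L : ℕ} (i : Fin L) (t : ℝ) :
    (channelLaw L).real {ω | t ≤ ‖ω.2 i‖ ^ 2} ≤ 2 * Real.exp (-(t / 2)) := by
  have h : MeasurePreserving (fun ω : ℂ × (Fin L → ℂ) => ω.2 i) (channelLaw L)
      stdComplexGaussian :=
    (measurePreserving_eval (fun _ : Fin L => stdComplexGaussian) i).comp measurePreserving_snd
  have hm : MeasurableSet {z : ℂ | t ≤ ‖z‖ ^ 2} := measurableSet_le measurable_const (by fun_prop)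
  exact (h.measureReal_preimage hm.nullMeasurableSet).trans_le (stdComplexGaussian_tail t)

lemma measurable_mutualInfo (η : ℝ) (l : ℕ) : Measurable fun h => mutualInfo η h l := by
  unfold mutualInfo Real.logb
  fun_prop

lemma notReached_eq (L : ℕ) (η θ : ℝ) (l : ℕ) :
    notReached L η θ l = stdComplexGaussian.real {h | mutualInfo η h l < θ} :=
  channelLaw_real_fst _ (measurableSet_lt (measurable_mutualInfo η l) measurable_const)

lemma notReached_zero (L : ℕ) {η θ : ℝ} (hθ : 0 < θ) : notReached L η θ 0 = 1 := by
  simp [notReached_eq, mutualInfo, hθ]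

lemma mutualInfo_lt_iff {η : ℝ} (hη : 0 < η) (θ : ℝ) (h : ℂ) {l : ℕ} (hl : 1 ≤ l) :
    mutualInfo η h l < θ ↔ 1 + η * ‖h‖ ^ 2 < 2 ^ (θ / l) := by
  have hl' : (0 : ℝ) < l := by positivity
  rw [mutualInfo, ← lt_div_iff₀' hl', Real.logb_lt_iff_lt_rpow one_lt_two (by positivity)]

lemma notReached_le (L : ℕ) {η : ℝ} (hη : 0 < η) (θ : ℝ) {l : ℕ} (hl : 1 ≤ l) :
    notReached L η θ l ≤ 2 ^ (θ / l) / η := by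
  rw [notReached_eq]
  refine le_trans (measureReal_mono fun h hh => ?_)
    (stdComplexGaussian_norm_sq_lt_le (x := 2 ^ (θ / l) / η) (by positivity))
  have := (mutualInfo_lt_iff hη θ h hl).1 hh
  show ‖h‖ ^ 2 < _
  rw [lt_div_iff₀ hη]
  linarith

lemma le_notReached (L : ℕ) {η : ℝ} (hη : 0 < η) (θ : ℝ) {l : ℕ} (hl : 1 ≤ l) :
    1 - 2 * Real.exp (-((2 ^ (θ / l) - 1) / η / 2)) ≤ notReached L η θ l := by
  have hm : MeasurableSet {h | mutualInfo η h l < θ} :=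
    measurableSet_lt (measurable_mutualInfo η l) measurable_const
  have hc := probReal_compl_eq_one_sub (μ := stdComplexGaussian) hm
  have ht := stdComplexGaussian_tail ((2 ^ (θ / l) - 1) / η)
  have hsub : {h | mutualInfo η h l < θ}ᶜ ⊆ {z : ℂ | (2 ^ (θ / l) - 1) / η ≤ ‖z‖ ^ 2} := by
    intro h hh
    have := not_lt.1 (mt (mutualInfo_lt_iff hη θ h hl).2 hh)
    show _ ≤ ‖h‖ ^ 2
    rw [div_le_iff₀ hη]
    linarith
  have := measureReal_mono (μ := stdComplexGaussian) hsub
  rw [notReached_eq]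
  linarith

section Codes

variable {L : ℕ} (c : PermCode L)

lemma norm_sq_symbol_le (l : Fin L) (m : Fin c.side × Fin c.side) : ‖c.symbol l m‖ ^ 2 ≤ 3 :=
  norm_sq_qam_le c.two_le_side _

lemma norm_sq_symbol_sub_le (l : Fin L) (m m' : Fin c.side × Fin c.side) :
    ‖c.symbol l m - c.symbol l m'‖ ^ 2 ≤ 12 := by
  have h1 := norm_sq_symbol_le c l m
  have h2 := norm_sq_symbol_le c l m'
  have h3 := norm_sub_le (c.symbol l m) (c.symbol l m')
  nlinarith [norm_nonneg (c.symbol l m), norm_nonneg (c.symbol l m'),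
    norm_nonneg (c.symbol l m - c.symbol l m'), sq_nonneg (‖c.symbol l m‖ - ‖c.symbol l m'‖)]

lemma norm_sq_sqrt_mul {η : ℝ} (hη : 0 ≤ η) (h z : ℂ) :
    ‖(Real.sqrt η : ℂ) * h * z‖ ^ 2 = η * ‖h‖ ^ 2 * ‖z‖ ^ 2 := by
  rw [norm_mul, norm_mul, mul_pow, mul_pow, Complex.norm_real, Real.norm_eq_abs, sq_abs,
    Real.sq_sqrt hη]

lemma measurableSet_decodingError (η : ℝ) (m : Fin c.side × Fin c.side) (l : ℕ) :
    MeasurableSet {ω : ℂ × (Fin L → ℂ) | DecodingError c η ω.1 ω.2 m l} := by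
  have hm : ∀ m', Measurable fun ω : ℂ × (Fin L → ℂ) => metric c η ω.1 ω.2 m m' l := fun m' => by
    unfold metric received
    fun_prop
  have : {ω : ℂ × (Fin L → ℂ) | DecodingError c η ω.1 ω.2 m l} =
      ⋃ m', {ω | m' ≠ m ∧ metric c η ω.1 ω.2 m m' l ≤ metric c η ω.1 ω.2 m m l} := by
    ext ω; simp [DecodingError]
  rw [this]
  exact MeasurableSet.iUnion fun m' =>
    (MeasurableSet.const _).inter (measurableSet_le (hm m') (hm m))

/-! ### Lower bound for the error probability -/

lemma metric_full (η : ℝ) (h : ℂ) (n : Fin L → ℂ) (m m' : Fin c.side × Fin c.side) :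
    metric c η h n m m' L = ∑ i, ‖((fun i => (Real.sqrt η : ℂ) * h * c.symbol i m) + n) i -
      (Real.sqrt η : ℂ) * h * c.symbol i m'‖ ^ 2 := by
  unfold metric received
  rw [Finset.filter_true_of_mem fun i _ => i.2]
  rfl

/-- For weak fading, decoding from all blocks is wrong with average probability at least `1 / 2`. -/
lemma half_le_sum_decodingError {η t : ℝ} (hη : 0 < η) (ht : 0 < t) (hL : 1 ≤ L)
    (hside : 2 * (1 + t) ^ L * Real.exp (1 / 2) ≤ (c.side : ℝ) ^ 2) {h : ℂ}
    (hh : ‖h‖ ^ 2 < t / (6 * L * η)) :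
    (c.side : ℝ) ^ 2 / 2 ≤ ∑ m : Fin c.side × Fin c.side,
      (Measure.pi fun _ : Fin L => stdComplexGaussian).real {n | DecodingError c η h n m L} := by
  set s : Fin c.side × Fin c.side → Fin L → ℂ :=
    fun m i => (Real.sqrt η : ℂ) * h * c.symbol i m with hs
  -- the decision regions
  set D : Fin c.side × Fin c.side → Set (Fin L → ℂ) := fun m =>
    {y | ∀ m', m' ≠ m → ∑ i, ‖y i - s m i‖ ^ 2 < ∑ i, ‖y i - s m' i‖ ^ 2} with hD
  have hL' : (0 : ℝ) < L := by positivity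
  have hDm : ∀ m, MeasurableSet (D m) := fun m => by
    rw [hD]
    simp only [Set.ofPred_forall]
    refine MeasurableSet.iInter fun m' => MeasurableSet.iInter fun _ => ?_
    exact measurableSet_lt (by fun_prop) (by fun_prop)
  have hdisj : Pairwise (Function.onFun Disjoint D) := fun m m' hmm => by
    refine Set.disjoint_left.2 fun y hy hy' => ?_
    exact lt_asymm (hy m' hmm.symm) (hy' m hmm)
  have henergy : ∀ m i, ‖s m i‖ ^ 2 ≤ 1 / (2 * L) * t := fun m i => by
    rw [hs]
    simp only
    rw [norm_sq_sqrt_mul hη.le]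
    have h1 := norm_sq_symbol_le c i m
    have h2 : η * ‖h‖ ^ 2 ≤ t / (6 * L) := by
      rw [lt_div_iff₀ (by positivity)] at hh
      rw [le_div_iff₀ (by positivity)]
      linarith
    calc η * ‖h‖ ^ 2 * ‖c.symbol i m‖ ^ 2 ≤ t / (6 * L) * 3 := by gcongr
      _ = _ := by field_simp; norm_num
  have hsum := sum_measure_correct_le s D hDm hdisj ht henergy
  have hcompl : ∀ m, {n | s m + n ∈ D m} = {n | DecodingError c η h n m L}ᶜ := fun m => by
    ext n
    simp only [hD, Set.mem_ofPred_eq, Set.mem_compl_iff, DecodingError, metric_full, not_exists,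
      not_and, not_le]
    rfl
  have hmeas : ∀ m, MeasurableSet {n | DecodingError c η h n m L} := fun m =>
    measurable_prodMk_left (measurableSet_decodingError c η m L)
  have hexp : ((1 + t) * Real.exp (1 / (2 * L))) ^ L = (1 + t) ^ L * Real.exp (1 / 2) := by
    rw [mul_pow, ← Real.exp_nat_mul]
    congr 2
    field_simp
  rw [hexp] at hsum
  have hsum' : ∑ m, (1 - (Measure.pi fun _ : Fin L => stdComplexGaussian).real
      {n | DecodingError c η h n m L}) ≤ (1 + t) ^ L * Real.exp (1 / 2) := by
    have h1 := ENNReal.toReal_le_of_le_ofReal (by positivity) hsum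
    rw [ENNReal.toReal_sum fun m _ => measure_ne_top _ _] at h1
    refine le_trans (le_of_eq (Finset.sum_congr rfl fun m _ => ?_)) h1
    rw [← probReal_compl_eq_one_sub (hmeas m), ← hcompl]
    rfl
  rw [Finset.sum_sub_distrib, Finset.sum_const, Finset.card_univ, Fintype.card_prod,
    Fintype.card_fin, nsmul_eq_mul] at hsum'
  push_cast at hsum'
  linarith

lemma le_errorProb {η θ t : ℝ} (hη : 0 < η) (ht : 0 < t) (hL : 1 ≤ L)
    (hside : 2 * (1 + t) ^ L * Real.exp (1 / 2) ≤ (c.side : ℝ) ^ 2) (hθ : L * c.rate ≤ θ) :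
    Real.exp (-1) * min 1 (t / (6 * L * η)) / 2 ≤ errorProb c η θ := by
  have hL' : (0 : ℝ) < L := by positivity
  have hL1 : (1 : ℝ) ≤ L := by exact_mod_cast hL
  set x := t / (6 * L * η) with hx
  set A : Set ℂ := {h | ‖h‖ ^ 2 < x} with hA
  have hside0 : (0 : ℝ) < c.side := by
    have := c.two_le_side
    positivity
  have hN : (0 : ℝ) < (c.side : ℝ) ^ 2 := by positivity
  -- in this event all mutual informations stay below the threshold
  have hdec : ∀ h ∈ A, DecodesAt L η θ h L := fun h hh => by
    refine ⟨fun k hk hkL => ?_, Or.inr rfl⟩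
    have hk' : (0 : ℝ) < k := by positivity
    have h1 : η * ‖h‖ ^ 2 < t := by
      have h2 : ‖h‖ ^ 2 < t / (6 * L * η) := hh
      rw [lt_div_iff₀ (by positivity)] at h2
      nlinarith [mul_nonneg hη.le (sq_nonneg ‖h‖)]
    have h3 : (1 + t) ^ L < (c.side : ℝ) ^ 2 := by
      have h4 : 1 ≤ Real.exp (1 / 2) := Real.one_le_exp (by norm_num)
      have h5 : 0 < (1 + t) ^ L := by positivity
      nlinarith
    calc mutualInfo η h k ≤ mutualInfo η h L := by
          unfold mutualInfo
          have : 0 ≤ Real.logb 2 (1 + η * ‖h‖ ^ 2) :=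
            Real.logb_nonneg one_lt_two (by nlinarith [mul_nonneg hη.le (sq_nonneg ‖h‖)])
          gcongr
      _ = Real.logb 2 ((1 + η * ‖h‖ ^ 2) ^ L) := by rw [mutualInfo, Real.logb_pow]
      _ < Real.logb 2 ((c.side : ℝ) ^ 2) := by
          refine Real.logb_lt_logb one_lt_two (by positivity) (lt_of_le_of_lt ?_ h3)
          gcongr
      _ = L * c.rate := by rw [PermCode.rate, mul_div_cancel₀ _ hL'.ne']
      _ ≤ θ := hθ
  have hAm : MeasurableSet A := measurableSet_norm_sq_lt x
  set E : Fin c.side × Fin c.side → Set (ℂ × (Fin L → ℂ)) := fun m =>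
    {ω | DecodingError c η ω.1 ω.2 m L} with hE
  have hEm : ∀ m, MeasurableSet (E m) := fun m => measurableSet_decodingError c η m L
  have hmain : ENNReal.ofReal ((c.side : ℝ) ^ 2 / 2) * stdComplexGaussian A ≤
      ∑ m, channelLaw L ({ω | ω.1 ∈ A} ∩ E m) := by
    have hprod : ∀ m, ∫⁻ h in A, (Measure.pi fun _ : Fin L => stdComplexGaussian)
        {n | DecodingError c η h n m L} ∂stdComplexGaussian ≤
          channelLaw L ({ω | ω.1 ∈ A} ∩ E m) := fun m => by
      have hm : MeasurableSet ({ω : ℂ × (Fin L → ℂ) | ω.1 ∈ A} ∩ E m) :=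
        (measurable_fst hAm).inter (hEm m)
      rw [channelLaw, Measure.prod_apply hm, ← lintegral_indicator hAm]
      refine lintegral_mono fun h => ?_
      by_cases hh : h ∈ A
      · rw [Set.indicator_of_mem hh]
        exact measure_mono fun n hn => ⟨hh, hn⟩
      · rw [Set.indicator_of_notMem hh]
        exact zero_le
    refine le_trans ?_ (Finset.sum_le_sum fun m _ => hprod m)
    have hmeas : ∀ m, Measurable fun h => (Measure.pi fun _ : Fin L => stdComplexGaussian)
        {n | DecodingError c η h n m L} := fun m => measurable_measure_prodMk_left (hEm m)
    rw [← lintegral_finsetSum _ fun m _ => hmeas m, ← setLIntegral_const]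
    refine setLIntegral_mono' hAm fun h hh => ?_
    have h1 := half_le_sum_decodingError c hη ht hL hside hh
    refine (ENNReal.ofReal_le_ofReal h1).trans (le_of_eq ?_)
    rw [ENNReal.ofReal_sum_of_nonneg fun _ _ => measureReal_nonneg]
    exact Finset.sum_congr rfl fun m _ => ofReal_measureReal
  have hmain' : (c.side : ℝ) ^ 2 / 2 * stdComplexGaussian.real A ≤
      ∑ m, (channelLaw L).real ({ω | ω.1 ∈ A} ∩ E m) := by
    have h1 := ENNReal.toReal_mono (ENNReal.sum_ne_top.2 fun m _ => measure_ne_top _ _) hmain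
    rwa [ENNReal.toReal_mul, ENNReal.toReal_ofReal (by positivity),
      ENNReal.toReal_sum fun m _ => measure_ne_top _ _] at h1
  have hγ := le_stdComplexGaussian_norm_sq_lt (x := x) (by positivity)
  calc Real.exp (-1) * min 1 x / 2
      ≤ stdComplexGaussian.real A / 2 := by gcongr
    _ = 1 / (c.side : ℝ) ^ 2 * ((c.side : ℝ) ^ 2 / 2 * stdComplexGaussian.real A) := by
        field_simp
    _ ≤ 1 / (c.side : ℝ) ^ 2 * ∑ m, (channelLaw L).real ({ω | ω.1 ∈ A} ∩ E m) := by gcongr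
    _ ≤ 1 / (c.side : ℝ) ^ 2 * ∑ m, (channelLaw L).real
          {ω | DecodesAt L η θ ω.1 L ∧ DecodingError c η ω.1 ω.2 m L} := by
        refine mul_le_mul_of_nonneg_left (Finset.sum_le_sum fun m _ => ?_) (by positivity)
        exact measureReal_mono fun ω hω => ⟨hdec _ hω.1, hω.2⟩
    _ ≤ errorProb c η θ :=
        Finset.single_le_sum (f := fun l => (1 / (c.side : ℝ) ^ 2) *
          ∑ m : Fin c.side × Fin c.side, (channelLaw L).real
            {ω | DecodesAt L η θ ω.1 l ∧ DecodingError c η ω.1 ω.2 m l})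
          (fun l _ => mul_nonneg (by positivity) (Finset.sum_nonneg fun _ _ => measureReal_nonneg))
          (Finset.mem_Icc.2 ⟨hL, le_rfl⟩)

/-! ### Upper bounds for the error probability -/

lemma errorProb_le_of_forall {η θ q : ℝ}
    (hq : ∀ l, 1 ≤ l → l ≤ L → ∀ m, (channelLaw L).real
      {ω | DecodesAt L η θ ω.1 l ∧ DecodingError c η ω.1 ω.2 m l} ≤ q) :
    errorProb c η θ ≤ L * q := by
  have hN : (0 : ℝ) < (c.side : ℝ) ^ 2 := by
    have := c.two_le_side
    positivity
  calc errorProb c η θ ≤ ∑ l ∈ Finset.Icc 1 L, q := by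
        refine Finset.sum_le_sum fun l hl => ?_
        obtain ⟨h1, h2⟩ := Finset.mem_Icc.1 hl
        have h3 : ∑ m : Fin c.side × Fin c.side, (channelLaw L).real
            {ω | DecodesAt L η θ ω.1 l ∧ DecodingError c η ω.1 ω.2 m l} ≤ (c.side : ℝ) ^ 2 * q := by
          refine (Finset.sum_le_sum fun m _ => hq l h1 h2 m).trans (le_of_eq ?_)
          simp [sq]
        rw [one_div_mul_eq_div, div_le_iff₀ hN]
        linarith
    _ = L * q := by simp

lemma errorProb_le_natCast (η θ : ℝ) : errorProb c η θ ≤ L := by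
  simpa using errorProb_le_of_forall c (η := η) (θ := θ) (q := 1) fun _ _ _ _ => measureReal_le_one

/-- If the mutual information has reached the threshold, a decoding error requires a large noise
value: the product distance criterion bounds the received distance from below. -/
lemma exists_noise_large {η θ G τ : ℝ} (hη : 0 < η) (hL : 1 ≤ L)
    (hG : ∀ m m' : Fin c.side × Fin c.side, m ≠ m' →
      (2 : ℝ) ^ (-G) ≤ ∏ l : Fin L, ‖c.symbol l m - c.symbol l m'‖ ^ 2)
    (hτ : G + τ ≤ θ) (hθ : L ≤ θ) (hτ1 : 24 ≤ (2 : ℝ) ^ (τ / L))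
    {l : ℕ} (hl : 1 ≤ l) (hlL : l ≤ L) {h : ℂ} {n : Fin L → ℂ} {m : Fin c.side × Fin c.side}
    (hI : θ ≤ mutualInfo η h l) (herr : DecodingError c η h n m l) :
    ∃ i, (2 : ℝ) ^ (τ / L) / (96 * L) ≤ ‖n i‖ ^ 2 := by
  have hL' : (0 : ℝ) < L := by positivity
  have hl' : (0 : ℝ) < l := by positivity
  have hlL' : (l : ℝ) ≤ L := by exact_mod_cast hlL
  obtain ⟨m', hmm, hmet⟩ := herr
  set snr := η * ‖h‖ ^ 2 with hsnr
  have hsnr0 : 0 ≤ snr := by positivity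
  set Δ : Fin L → ℝ := fun i => ‖c.symbol i m - c.symbol i m'‖ ^ 2 with hΔ
  have hΔ0 : ∀ i, 0 ≤ Δ i := fun i => by positivity
  set s : Finset (Fin L) := Finset.univ.filter fun i => i.val < l with hs
  have hcard : s.card = l := by
    rw [hs, Fin.card_filter_val_lt, min_eq_right hlL]
  set d := ∑ i ∈ s, Δ i with hd
  have hd0 : 0 ≤ d := Finset.sum_nonneg fun i _ => hΔ0 i
  -- the product over the first `l` subchannels
  have hprod : (2 : ℝ) ^ (-G) ≤ d ^ l * 12 ^ L := by
    calc (2 : ℝ) ^ (-G) ≤ ∏ i, Δ i := hG m m' hmm.symm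
      _ = (∏ i ∈ s, Δ i) * ∏ i ∈ Finset.univ.filter (fun i : Fin L => ¬ i.val < l), Δ i :=
          (Finset.prod_filter_mul_prod_filter_not _ _ _).symm
      _ ≤ d ^ l * 12 ^ L := by
          refine mul_le_mul ?_ ?_ (Finset.prod_nonneg fun i _ => hΔ0 i) (by positivity)
          · rw [← hcard]
            rw [← Finset.prod_const]
            exact Finset.prod_le_prod (fun i _ => hΔ0 i) fun i hi =>
              Finset.single_le_sum (fun i _ => hΔ0 i) hi
          · refine (Finset.prod_le_prod (fun i _ => hΔ0 i) fun i _ =>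
              norm_sq_symbol_sub_le c i m m').trans ?_
            rw [Finset.prod_const]
            refine pow_le_pow_right₀ (by norm_num) ?_
            exact (Finset.card_le_univ _).trans_eq (Fintype.card_fin L)
  have hpow : (2 : ℝ) ^ θ ≤ (1 + snr) ^ l := by
    rw [mutualInfo, ← Real.logb_pow] at hI
    rwa [Real.le_logb_iff_rpow_le one_lt_two (by positivity)] at hI
  have hsnr1 : 1 ≤ snr := by
    have h1 : (2 : ℝ) ^ l ≤ (1 + snr) ^ l := by
      refine le_trans ?_ hpow
      rw [← Real.rpow_natCast]
      exact Real.rpow_le_rpow_of_exponent_le one_le_two (hlL'.trans hθ)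
    have h2 := le_of_pow_le_pow_left₀ (by omega) (by positivity) h1
    linarith
  set z := (2 : ℝ) ^ (τ / L) / 24 with hz
  have hz1 : 1 ≤ z := by rw [hz, le_div_iff₀ (by norm_num)]; linarith
  have hdist : z ≤ snr * d := by
    refine le_of_pow_le_pow_left₀ (n := l) (by omega) (by positivity) ?_
    have hzL : z ^ L * 24 ^ L = (2 : ℝ) ^ τ := by
      rw [← mul_pow, hz, div_mul_cancel₀ _ (by norm_num), ← Real.rpow_mul_natCast two_pos.le,
        div_mul_cancel₀ _ hL'.ne']
    have h1 : (2 : ℝ) ^ θ ≤ (2 * snr) ^ l := hpow.trans (by gcongr; linarith)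
    have h2 : (2 : ℝ) ^ τ ≤ (2 : ℝ) ^ θ * (2 : ℝ) ^ (-G) := by
      rw [← Real.rpow_add two_pos]
      exact Real.rpow_le_rpow_of_exponent_le one_le_two (by linarith)
    have h3 : z ^ L * 24 ^ L ≤ (snr * d) ^ l * 24 ^ L := by
      calc z ^ L * 24 ^ L ≤ (2 : ℝ) ^ θ * (2 : ℝ) ^ (-G) := by rw [hzL]; exact h2
        _ ≤ (2 * snr) ^ l * (d ^ l * 12 ^ L) := by gcongr
        _ = (snr * d) ^ l * (2 ^ l * 12 ^ L) := by rw [mul_pow, mul_pow]; ring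
        _ ≤ (snr * d) ^ l * (2 ^ L * 12 ^ L) := by gcongr; exact one_le_two
        _ = _ := by rw [← mul_pow]; norm_num
    calc z ^ l ≤ z ^ L := pow_le_pow_right₀ hz1 hlL
      _ ≤ _ := le_of_mul_le_mul_right h3 (by positivity)
  -- the noise vector is at least half as long as the received difference
  have hnoise : snr * d ≤ 4 * ∑ i ∈ s, ‖n i‖ ^ 2 := by
    have h1 : metric c η h n m m l = ∑ i ∈ s, ‖n i‖ ^ 2 := by
      unfold metric received
      simp [hs]
    have h2 : metric c η h n m m' l =
        ∑ i ∈ s, ‖(Real.sqrt η : ℂ) * h * (c.symbol i m - c.symbol i m') + n i‖ ^ 2 := by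
      unfold metric received
      refine Finset.sum_congr rfl fun i _ => ?_
      congr 2
      ring
    rw [h1, h2] at hmet
    have h3 : ∀ i ∈ s, snr * Δ i ≤
        2 * ‖(Real.sqrt η : ℂ) * h * (c.symbol i m - c.symbol i m') + n i‖ ^ 2 +
          2 * ‖n i‖ ^ 2 := fun i _ => by
      rw [hsnr, hΔ]
      simp only
      rw [← norm_sq_sqrt_mul hη.le]
      set w := (Real.sqrt η : ℂ) * h * (c.symbol i m - c.symbol i m') with hw
      have h4 : ‖w‖ ≤ ‖w + n i‖ + ‖n i‖ := by simpa using norm_sub_le (w + n i) (n i)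
      nlinarith [norm_nonneg w, sq_nonneg (‖w + n i‖ - ‖n i‖)]
    have h5 := Finset.sum_le_sum h3
    rw [← Finset.mul_sum, Finset.sum_add_distrib, ← Finset.mul_sum, ← Finset.mul_sum] at h5
    linarith
  by_contra! hcon
  have h6 : ∑ i ∈ s, ‖n i‖ ^ 2 < ∑ i ∈ s, (2 : ℝ) ^ (τ / L) / (96 * L) := by
    refine Finset.sum_lt_sum_of_nonempty ?_ fun i _ => hcon i
    rw [← Finset.card_pos, hcard]
    omega
  rw [Finset.sum_const, hcard, nsmul_eq_mul] at h6
  have h7 : (l : ℝ) * ((2 : ℝ) ^ (τ / L) / (96 * L)) ≤ z / 4 := by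
    calc (l : ℝ) * ((2 : ℝ) ^ (τ / L) / (96 * L)) ≤ L * ((2 : ℝ) ^ (τ / L) / (96 * L)) := by gcongr
      _ = z / 4 := by rw [hz]; field_simp; norm_num
  linarith

lemma errorProb_le {η θ G τ : ℝ} (hη : 0 < η) (hL : 1 ≤ L)
    (hG : ∀ m m' : Fin c.side × Fin c.side, m ≠ m' →
      (2 : ℝ) ^ (-G) ≤ ∏ l : Fin L, ‖c.symbol l m - c.symbol l m'‖ ^ 2)
    (hτ : G + τ ≤ θ) (hθ : L ≤ θ) (hτ1 : 24 ≤ (2 : ℝ) ^ (τ / L)) :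
    errorProb c η θ ≤ L * (2 ^ (θ / L) / η +
      L * (2 * Real.exp (-((2 : ℝ) ^ (τ / L) / (96 * L) / 2)))) := by
  refine errorProb_le_of_forall c fun l hl hlL m => ?_
  set T := (2 : ℝ) ^ (τ / L) / (96 * L) with hT
  have hsub : {ω : ℂ × (Fin L → ℂ) | DecodesAt L η θ ω.1 l ∧ DecodingError c η ω.1 ω.2 m l} ⊆
      {ω | mutualInfo η ω.1 L < θ} ∪ ⋃ i, {ω | T ≤ ‖ω.2 i‖ ^ 2} := by
    rintro ω ⟨⟨-, hdec⟩, herr⟩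
    by_cases hI : θ ≤ mutualInfo η ω.1 l
    · obtain ⟨i, hi⟩ := exists_noise_large c hη hL hG hτ hθ hτ1 hl hlL hI herr
      exact Or.inr (Set.mem_iUnion.2 ⟨i, hi⟩)
    · rcases hdec with h | rfl
      · exact absurd h hI
      · exact Or.inl (not_le.1 hI)
  calc _ ≤ (channelLaw L).real ({ω | mutualInfo η ω.1 L < θ} ∪ ⋃ i, {ω | T ≤ ‖ω.2 i‖ ^ 2}) :=
        measureReal_mono hsub
    _ ≤ notReached L η θ L + (channelLaw L).real (⋃ i, {ω | T ≤ ‖ω.2 i‖ ^ 2}) :=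
        measureReal_union_le _ _
    _ ≤ 2 ^ (θ / L) / η + L * (2 * Real.exp (-(T / 2))) := by
        refine add_le_add (notReached_le L hη θ hL) ?_
        calc _ ≤ ∑ i : Fin L, (channelLaw L).real {ω | T ≤ ‖ω.2 i‖ ^ 2} :=
              measureReal_iUnion_fintype_le _
          _ ≤ ∑ _ : Fin L, 2 * Real.exp (-(T / 2)) :=
              Finset.sum_le_sum fun i _ => channelLaw_real_noise_tail i T
          _ = _ := by simp

end Codes

/-! ### Asymptotics -/

/-- The error probability is at least of the order of the probability that the mutual information of
one block stays below the rate `R`. -/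
lemma exists_const_le_errorProb {L : ℕ} (hL : 1 ≤ L) :
    ∃ K : ℝ, 0 < K ∧ ∀ (c : PermCode L) (η θ : ℝ), 0 < η → L * c.rate ≤ θ →
      K * min 1 ((2 : ℝ) ^ c.rate / η) ≤ errorProb c η θ := by
  have hL' : (0 : ℝ) < L := by positivity
  set β : ℝ := (3 / 10 : ℝ) ^ ((L : ℝ)⁻¹) with hβ
  set γ : ℝ := (1 / 4 : ℝ) ^ ((L : ℝ)⁻¹) with hγ
  have hβL : β ^ L = 3 / 10 := Real.rpow_inv_natCast_pow (by norm_num) (by omega)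
  have hγL : γ ^ L = 1 / 4 := Real.rpow_inv_natCast_pow (by norm_num) (by omega)
  have hγ0 : 0 < γ := by positivity
  have hκ : 0 < β - γ :=
    sub_pos.2 (Real.rpow_lt_rpow (by norm_num) (by norm_num) (by positivity))
  set κ := β - γ with hκdef
  refine ⟨Real.exp (-1) * min 1 (κ / (6 * L)) / 2, by positivity, fun c η θ hη hθ => ?_⟩
  set x := (2 : ℝ) ^ c.rate with hx
  have hx0 : 0 < x := by positivity
  have hxL : x ^ L = (c.side : ℝ) ^ 2 := by
    rw [hx, ← Real.rpow_mul_natCast two_pos.le, mul_comm, PermCode.two_rpow_mul_rate hL]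
  have hside : (2 : ℝ) ≤ c.side := by exact_mod_cast c.two_le_side
  -- there are at least four messages
  have hxγ : 1 ≤ x * γ := by
    refine le_of_pow_le_pow_left₀ (n := L) (by omega) (by positivity) ?_
    rw [one_pow, mul_pow, hxL, hγL]
    nlinarith
  have hle : 1 + κ * x ≤ x * β := by rw [hκdef]; nlinarith
  have hexp : Real.exp (1 / 2) ≤ 5 / 3 := by
    have h1 : Real.exp (1 / 2) ^ 2 = Real.exp 1 := by
      rw [← Real.exp_nat_mul]; norm_num
    have h2 := Real.exp_one_lt_d9
    refine le_of_pow_le_pow_left₀ (n := 2) two_ne_zero (by norm_num) ?_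
    rw [h1]
    linarith
  have hcond : 2 * (1 + κ * x) ^ L * Real.exp (1 / 2) ≤ (c.side : ℝ) ^ 2 := by
    have h1 : (1 + κ * x) ^ L ≤ (c.side : ℝ) ^ 2 * (3 / 10) := by
      rw [← hβL, ← hxL, ← mul_pow]
      gcongr
    calc 2 * (1 + κ * x) ^ L * Real.exp (1 / 2)
        ≤ 2 * ((c.side : ℝ) ^ 2 * (3 / 10)) * (5 / 3) := by gcongr
      _ = _ := by ring
  refine le_trans ?_ (le_errorProb c hη (mul_pos hκ hx0) hL hcond hθ)
  have hmin : min 1 (κ / (6 * L)) * min 1 (x / η) ≤ min 1 (κ * x / (6 * L * η)) := by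
    refine le_min ?_ ?_
    · exact mul_le_one₀ (min_le_left _ _) (by positivity) (min_le_left _ _)
    · calc min 1 (κ / (6 * L)) * min 1 (x / η) ≤ κ / (6 * L) * (x / η) := by
            gcongr <;> exact min_le_right _ _
        _ = _ := by field_simp
  calc _ = Real.exp (-1) * (min 1 (κ / (6 * L)) * min 1 (x / η)) / 2 := by ring
    _ ≤ _ := by gcongr

/-- The exponential order of a function squeezed between two functions of that order. -/
lemma hasDiversity_of_le_of_le {P u v : ℝ → ℝ} {d K K' : ℝ} (hK : 0 < K) (hK' : 0 < K')
    (hu : Tendsto (fun η => u η / Real.logb 2 η) atTop (𝓝 (-d)))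
    (hv : Tendsto (fun η => v η / Real.logb 2 η) atTop (𝓝 (-d)))
    (hlow : ∀ᶠ η in atTop, K * 2 ^ u η ≤ P η) (hup : ∀ᶠ η in atTop, P η ≤ K' * 2 ^ v η) :
    HasDiversity P d := by
  have hpos : ∀ᶠ η in atTop, 0 < P η := hlow.mono fun η h => lt_of_lt_of_le (by positivity) h
  refine ⟨hpos, ?_⟩
  have hlim : ∀ {w : ℝ → ℝ} (k : ℝ), Tendsto (fun η => w η / Real.logb 2 η) atTop (𝓝 (-d)) →
      Tendsto (fun η => (Real.logb 2 k + w η) / Real.logb 2 η) atTop (𝓝 (-d)) := fun k hw => by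
    have h := (tendsto_const_nhds (x := Real.logb 2 k)).div_atTop tendsto_logb_two_atTop |>.add hw
    simpa [add_div] using h
  have hlog : ∀ {k : ℝ} (w : ℝ), 0 < k → Real.logb 2 (k * 2 ^ w) = Real.logb 2 k + w :=
    fun w hk => by
      rw [Real.logb_mul hk.ne' (by positivity), Real.logb_rpow two_pos (by norm_num)]
  rw [← neg_neg d]
  refine Tendsto.neg (tendsto_of_tendsto_of_tendsto_of_le_of_le' (hlim K hu) (hlim K' hv) ?_ ?_)
  · filter_upwards [hlow, eventually_gt_atTop 1] with η h h1
    have h2 : 0 < Real.logb 2 η := Real.logb_pos one_lt_two h1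
    rw [← hlog _ hK]
    gcongr
    exact one_lt_two
  · filter_upwards [hup, hpos, eventually_gt_atTop 1] with η h h0 h1
    have h2 : 0 < Real.logb 2 η := Real.logb_pos one_lt_two h1
    rw [← hlog _ hK']
    gcongr
    exact one_lt_two

/-- The least `g ≥ 0` such that all product distances of the code are at least
`2 ^ (-(L * R + g))`. -/
noncomputable def productDeficit {L : ℕ} (c : PermCode L) : ℝ :=
  ⨆ q : (Fin c.side × Fin c.side) × (Fin c.side × Fin c.side),
    if q.1 = q.2 then 0 else
      max 0 (-Real.logb 2 (∏ l : Fin L, ‖c.symbol l q.1 - c.symbol l q.2‖ ^ 2) - L * c.rate)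

lemma productDeficit_nonneg {L : ℕ} (c : PermCode L) : 0 ≤ productDeficit c :=
  Real.iSup_nonneg fun q => by split_ifs <;> simp

lemma tendsto_productDeficit {L : ℕ} {C : ℝ → PermCode L} (hC : ApproxUniversal C) :
    Tendsto (fun η => productDeficit (C η) / Real.logb 2 η) atTop (𝓝 0) := by
  rw [Metric.tendsto_nhds]
  intro ε hε
  filter_upwards [hC (ε / 2) (by positivity), eventually_gt_atTop 1] with η h h1
  have hη : 0 < η := by linarith
  have hΛ : 0 < Real.logb 2 η := Real.logb_pos one_lt_two h1
  have hle : productDeficit (C η) ≤ ε / 2 * Real.logb 2 η := by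
    refine Real.iSup_le (fun q => ?_) (by positivity)
    split_ifs with hq
    · positivity
    · refine max_le (by positivity) ?_
      have h2 := Real.logb_le_logb_of_le one_lt_two (by positivity) (h q.1 q.2 hq)
      rw [Real.logb_mul (by positivity) (by positivity), Real.logb_rpow two_pos (by norm_num),
        Real.logb_rpow_eq_mul_logb_of_pos hη] at h2
      linarith
  rw [Real.dist_eq, sub_zero, abs_of_nonneg (div_nonneg (productDeficit_nonneg _) hΛ.le),
    div_lt_iff₀ hΛ]
  nlinarith

lemma two_rpow_le_prod_of_approxUniversal {L : ℕ} {C : ℝ → PermCode L} (hC : ApproxUniversal C) :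
    ∀ᶠ η in atTop, ∀ m m' : Fin (C η).side × Fin (C η).side, m ≠ m' →
      (2 : ℝ) ^ (-(L * (C η).rate + productDeficit (C η))) ≤
        ∏ l : Fin L, ‖(C η).symbol l m - (C η).symbol l m'‖ ^ 2 := by
  filter_upwards [hC 1 one_pos, eventually_gt_atTop 0] with η h hη m m' hmm
  have hpos : 0 < ∏ l : Fin L, ‖(C η).symbol l m - (C η).symbol l m'‖ ^ 2 :=
    lt_of_lt_of_le (by positivity) (h m m' hmm)
  rw [← Real.le_logb_iff_rpow_le one_lt_two hpos]
  have hsup := le_ciSup (f := fun q : (Fin (C η).side × Fin (C η).side) ×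
      (Fin (C η).side × Fin (C η).side) => if q.1 = q.2 then (0 : ℝ) else
      max 0 (-Real.logb 2 (∏ l : Fin L, ‖(C η).symbol l q.1 - (C η).symbol l q.2‖ ^ 2) -
        L * (C η).rate)) (Set.finite_range _).bddAbove (m, m')
  simp only [if_neg hmm] at hsup
  have h2 := (le_max_right _ _).trans hsup
  change _ ≤ productDeficit (C η) at h2
  linarith

/-- The back-off: it makes up for the deficit of the product distances and for the deviation of
the rate from its multiplexing gain; the square root makes it tend to infinity. -/
noncomputable def backoff {L : ℕ} (C : ℝ → PermCode L) (rn η : ℝ) : ℝ :=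
  productDeficit (C η) + L * |(C η).rate - rn * Real.logb 2 η| + Real.sqrt (Real.logb 2 η)

lemma backoff_nonneg {L : ℕ} (C : ℝ → PermCode L) (rn η : ℝ) : 0 ≤ backoff C rn η := by
  have := productDeficit_nonneg (C η)
  unfold backoff
  positivity

lemma tendsto_sqrt_logb_atTop : Tendsto (fun η => Real.sqrt (Real.logb 2 η)) atTop atTop :=
  Real.tendsto_sqrt_atTop.comp tendsto_logb_two_atTop

section Family

variable {L : ℕ} {C : ℝ → PermCode L} {rn : ℝ}

lemma tendsto_backoff (hC : ApproxUniversal C) (hrate : HasMultiplexingGain C rn) :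
    Tendsto (fun η => backoff C rn η / Real.logb 2 η) atTop (𝓝 0) := by
  have h1 : Tendsto (fun η => (L : ℝ) * |(C η).rate / Real.logb 2 η - rn|) atTop (𝓝 0) := by
    simpa using ((hrate.sub_const rn).abs.const_mul (L : ℝ))
  have h2 : Tendsto (fun η => 1 / Real.sqrt (Real.logb 2 η)) atTop (𝓝 0) :=
    tendsto_const_nhds.div_atTop tendsto_sqrt_logb_atTop
  have h := ((tendsto_productDeficit hC).add h1).add h2
  rw [add_zero, add_zero] at h
  refine h.congr' ?_
  filter_upwards [eventually_gt_atTop 1] with η hη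
  have hΛ : 0 < Real.logb 2 η := Real.logb_pos one_lt_two hη
  rw [backoff, add_div, add_div, Real.sqrt_div_self, mul_div_assoc, ← abs_of_pos hΛ, ← abs_div,
    abs_of_pos hΛ, sub_div, mul_div_cancel_right₀ _ hΛ.ne', one_div]

lemma tendsto_threshold (hC : ApproxUniversal C) (hrate : HasMultiplexingGain C rn) :
    Tendsto (fun η => (L * (C η).rate + backoff C rn η) / Real.logb 2 η) atTop (𝓝 (L * rn)) := by
  have h := (hrate.const_mul (L : ℝ)).add (tendsto_backoff hC hrate)
  simpa [add_div, mul_div_assoc] using h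

lemma le_threshold (η : ℝ) : L * rn * Real.logb 2 η + Real.sqrt (Real.logb 2 η) ≤
    L * (C η).rate + backoff C rn η := by
  have h1 := productDeficit_nonneg (C η)
  have h2 : (L : ℝ) * (rn * Real.logb 2 η - (C η).rate) ≤
      L * |(C η).rate - rn * Real.logb 2 η| := by
    gcongr
    rw [abs_sub_comm]
    exact le_abs_self _
  unfold backoff
  linarith

lemma two_rpow_sub_logb {η : ℝ} (hη : 0 < η) (x : ℝ) :
    (2 : ℝ) ^ (x - Real.logb 2 η) = 2 ^ x / η := by
  rw [Real.rpow_sub two_pos, Real.rpow_logb two_pos (by norm_num) hη]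

lemma tendsto_two_rpow_atTop : Tendsto (fun x : ℝ => (2 : ℝ) ^ x) atTop atTop :=
  tendsto_rpow_atTop_of_base_gt_one 2 one_lt_two

/-- Levels `k ≤ L * rn` are missed with probability tending to one. At equality, the growth of the
back-off decides. -/
lemma tendsto_notReached_one (hL : 1 ≤ L) {k : ℕ} (hk : (k : ℝ) ≤ L * rn) :
    Tendsto (fun η => notReached L η (L * (C η).rate + backoff C rn η) k) atTop (𝓝 1) := by
  rcases Nat.eq_zero_or_pos k with rfl | hk1
  · refine tendsto_const_nhds.congr' ?_
    filter_upwards with η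
    refine (notReached_zero L ?_).symm
    have h1 : 0 < L * (C η).rate := by
      have h2 : (2 : ℝ) ≤ (C η).side := by exact_mod_cast (C η).two_le_side
      have h3 : 0 < Real.logb 2 (((C η).side : ℝ) ^ 2) := Real.logb_pos one_lt_two (by nlinarith)
      unfold PermCode.rate
      positivity
    linarith [backoff_nonneg C rn η]
  · have hk' : (0 : ℝ) < k := by positivity
    have hlim : Tendsto (fun η => 1 - 2 * Real.exp
        (-(((2 : ℝ) ^ (Real.sqrt (Real.logb 2 η) / k) - 1) / 2))) atTop (𝓝 1) := by
      have h1 : Tendsto (fun η => ((2 : ℝ) ^ (Real.sqrt (Real.logb 2 η) / k) - 1) / 2)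
          atTop atTop :=
        (tendsto_atTop_add_const_right _ (-1) (tendsto_two_rpow_atTop.comp
          (tendsto_sqrt_logb_atTop.atTop_div_const hk'))).atTop_div_const two_pos
      have h2 := ((Real.tendsto_exp_neg_atTop_nhds_zero.comp h1).const_mul 2).const_sub 1
      simpa using h2
    refine tendsto_of_tendsto_of_tendsto_of_le_of_le' hlim tendsto_const_nhds ?_
      (Eventually.of_forall fun η => measureReal_le_one)
    filter_upwards [eventually_gt_atTop 1] with η hη
    have hη0 : 0 < η := by linarith
    have hΛ : 0 < Real.logb 2 η := Real.logb_pos one_lt_two hη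
    refine le_trans ?_ (le_notReached L hη0 _ hk1)
    set θ := L * (C η).rate + backoff C rn η with hθ
    have h1 : Real.sqrt (Real.logb 2 η) / k ≤ θ / k - Real.logb 2 η := by
      rw [le_sub_iff_add_le, le_div_iff₀ hk', add_mul, div_mul_cancel₀ _ hk'.ne']
      have h2 := le_threshold (C := C) (rn := rn) η
      nlinarith
    have h2 : (2 : ℝ) ^ (Real.sqrt (Real.logb 2 η) / k) ≤ 2 ^ (θ / k) / η := by
      rw [← two_rpow_sub_logb hη0]
      exact Real.rpow_le_rpow_of_exponent_le one_le_two h1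
    have h3 : (2 : ℝ) ^ (Real.sqrt (Real.logb 2 η) / k) - 1 ≤ (2 ^ (θ / k) - 1) / η := by
      rw [sub_div]
      have : 1 / η ≤ 1 := by rw [div_le_one hη0]; exact hη.le
      linarith
    gcongr

lemma tendsto_notReached_zero (hC : ApproxUniversal C) (hrate : HasMultiplexingGain C rn)
    {k : ℕ} (hk1 : 1 ≤ k) (hk : L * rn < k) :
    Tendsto (fun η => notReached L η (L * (C η).rate + backoff C rn η) k) atTop (𝓝 0) := by
  have hk' : (0 : ℝ) < k := by positivity
  have hexp : Tendsto (fun η => Real.logb 2 η *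
      ((L * (C η).rate + backoff C rn η) / Real.logb 2 η / k - 1)) atTop atBot := by
    refine tendsto_logb_two_atTop.atTop_mul_neg (C := L * rn / k - 1) ?_
      (((tendsto_threshold hC hrate).div_const _).sub_const 1)
    rw [sub_neg, div_lt_one hk']
    exact hk
  have hlim := (tendsto_rpow_atBot_of_base_gt_one 2 one_lt_two).comp hexp
  refine tendsto_of_tendsto_of_tendsto_of_le_of_le' tendsto_const_nhds hlim
    (Eventually.of_forall fun η => measureReal_nonneg) ?_
  filter_upwards [eventually_gt_atTop 1] with η hη
  have hη0 : 0 < η := by linarith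
  have hΛ : 0 < Real.logb 2 η := Real.logb_pos one_lt_two hη
  refine (notReached_le L hη0 _ hk1).trans (le_of_eq ?_)
  rw [← two_rpow_sub_logb hη0, Function.comp_apply]
  congr 1
  field_simp

lemma hasEffectiveGain_avgRate (hL : 1 ≤ L) (hC : ApproxUniversal C)
    (hrate : HasMultiplexingGain C rn) {l : ℕ} (hl : 1 ≤ l) (hlL : l ≤ L)
    (h1 : ((l : ℝ) - 1) / L ≤ rn) (h2 : rn < (l : ℝ) / L) :
    HasEffectiveGain (fun η => avgRate (C η) η (L * (C η).rate + backoff C rn η))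
      (rn * (L / l)) := by
  have hL' : (0 : ℝ) < L := by positivity
  have hl' : (0 : ℝ) < l := by positivity
  rw [div_le_iff₀ hL'] at h1
  rw [lt_div_iff₀ hL'] at h2
  have hsum : Tendsto (fun η => ∑ k ∈ Finset.range L,
      notReached L η (L * (C η).rate + backoff C rn η) k) atTop (𝓝 l) := by
    have h : (l : ℝ) = ∑ k ∈ Finset.range L, if k < l then (1 : ℝ) else 0 := by
      rw [← Finset.sum_filter, Finset.sum_const, nsmul_one]
      have hf : (Finset.range L).filter (· < l) = Finset.range l := by
        ext k
        simp only [Finset.mem_filter, Finset.mem_range]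
        omega
      rw [hf, Finset.card_range]
    rw [h]
    refine tendsto_finsetSum _ fun k _ => ?_
    split_ifs with hk
    · refine tendsto_notReached_one hL ?_
      have h3 : (k : ℝ) + 1 ≤ l := by exact_mod_cast hk
      linarith
    · refine tendsto_notReached_zero hC hrate (by omega) ?_
      have h3 : (l : ℝ) ≤ k := by exact_mod_cast not_lt.1 hk
      linarith
  have h := (hrate.const_mul (L : ℝ)).div hsum hl'.ne'
  have hlim : (L : ℝ) * rn / l = rn * (L / l) := by ring
  rw [hlim] at h
  refine h.congr fun η => ?_
  unfold avgRate
  simp only [Pi.div_apply]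
  ring

lemma eventually_le_errorProb (hL : 1 ≤ L) :
    ∃ K : ℝ, 0 < K ∧ ∀ᶠ η in atTop, K * 2 ^ (min 0 ((C η).rate - Real.logb 2 η)) ≤
      errorProb (C η) η (L * (C η).rate + backoff C rn η) := by
  obtain ⟨K, hK, h⟩ := exists_const_le_errorProb hL
  refine ⟨K, hK, ?_⟩
  filter_upwards [eventually_gt_atTop 0] with η hη
  refine le_trans (le_of_eq ?_) (h (C η) η _ hη (le_add_of_nonneg_right (backoff_nonneg C rn η)))
  rw [(Real.monotone_rpow_of_base_ge_one one_le_two).map_min, Real.rpow_zero,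
    two_rpow_sub_logb hη]

lemma tendsto_min_rate_sub (hrate : HasMultiplexingGain C rn) :
    Tendsto (fun η => min 0 ((C η).rate - Real.logb 2 η) / Real.logb 2 η) atTop
      (𝓝 (min 0 (rn - 1))) := by
  refine ((tendsto_const_nhds (x := (0 : ℝ))).min (hrate.sub_const 1)).congr' ?_
  filter_upwards [eventually_gt_atTop 1] with η hη
  have hΛ : 0 < Real.logb 2 η := Real.logb_pos one_lt_two hη
  rw [← min_div_div_right hΛ.le, zero_div, sub_div, div_self hΛ.ne']

lemma eventually_exp_neg_le (hL : 1 ≤ L) : ∀ᶠ η in atTop,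
    Real.exp (-((2 : ℝ) ^ (Real.sqrt (Real.logb 2 η) / L) / (96 * L) / 2)) ≤ 1 / η := by
  have hL' : (0 : ℝ) < L := by positivity
  have hlog2 : 0 < Real.log 2 := Real.log_pos one_lt_two
  have ho := (isLittleO_pow_exp_pos_mul_atTop (k := 2) (div_pos hlog2 hL')).const_mul_left
    (Real.log 2 * (192 * L))
  have hev := tendsto_sqrt_logb_atTop.eventually (ho.bound one_pos)
  filter_upwards [hev, eventually_gt_atTop 1] with η h hη
  have hη0 : 0 < η := by linarith
  have hΛ : 0 < Real.logb 2 η := Real.logb_pos one_lt_two hη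
  rw [Real.sq_sqrt hΛ.le, Real.norm_of_nonneg (by positivity), Real.norm_of_nonneg (by positivity),
    one_mul] at h
  have h1 : Real.log 2 * Real.logb 2 η = Real.log η := by
    rw [Real.logb, mul_div_cancel₀ _ hlog2.ne']
  have h2 : (2 : ℝ) ^ (Real.sqrt (Real.logb 2 η) / L) =
      Real.exp (Real.log 2 / L * Real.sqrt (Real.logb 2 η)) := by
    rw [Real.rpow_def_of_pos two_pos]
    congr 1
    ring
  rw [one_div, ← Real.exp_log hη0, ← Real.exp_neg, Real.exp_log hη0, Real.exp_le_exp, neg_le_neg_iff,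
    div_div, le_div_iff₀ (by positivity), h2, ← h1]
  linarith

lemma eventually_errorProb_le (hL : 1 ≤ L) (hrn : 0 ≤ rn) (hC : ApproxUniversal C) :
    ∀ᶠ η in atTop, errorProb (C η) η (L * (C η).rate + backoff C rn η) ≤
      (L * (1 + L * 2)) * 2 ^ ((L * (C η).rate + backoff C rn η) / L - Real.logb 2 η) := by
  have hL' : (0 : ℝ) < L := by positivity
  have h24 : ∀ᶠ η in atTop, 24 ≤ (2 : ℝ) ^ (Real.sqrt (Real.logb 2 η) / L) :=
    (tendsto_two_rpow_atTop.comp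
      (tendsto_sqrt_logb_atTop.atTop_div_const hL')).eventually_ge_atTop 24
  filter_upwards [two_rpow_le_prod_of_approxUniversal hC, h24, eventually_exp_neg_le hL,
    tendsto_sqrt_logb_atTop.eventually_ge_atTop (L : ℝ), eventually_gt_atTop 1]
    with η hG h24 hexp hsqrt hη
  have hη0 : 0 < η := by linarith
  have hΛ : 0 < Real.logb 2 η := Real.logb_pos one_lt_two hη
  set θ := L * (C η).rate + backoff C rn η with hθ
  have hθL : L ≤ θ := by
    have h1 := le_threshold (C := C) (rn := rn) η
    have h2 : 0 ≤ L * rn * Real.logb 2 η := by positivity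
    linarith
  have hτ : L * (C η).rate + productDeficit (C η) + Real.sqrt (Real.logb 2 η) ≤ θ := by
    have h1 : 0 ≤ (L : ℝ) * |(C η).rate - rn * Real.logb 2 η| := by positivity
    rw [hθ, backoff]
    linarith
  refine (errorProb_le (C η) hη0 hL hG hτ hθL h24).trans ?_
  rw [two_rpow_sub_logb hη0]
  have h3 : 1 / η ≤ 2 ^ (θ / L) / η := by
    gcongr
    exact Real.one_le_rpow one_le_two (div_nonneg (hL'.le.trans hθL) hL'.le)
  calc _ ≤ (L : ℝ) * (2 ^ (θ / L) / η + L * (2 * (2 ^ (θ / L) / η))) := by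
        gcongr
        exact hexp.trans h3
    _ = _ := by ring

lemma hasDiversity_of_lt_one (hL : 1 ≤ L) (hrn : 0 ≤ rn) (hrn1 : rn < 1) (hC : ApproxUniversal C)
    (hrate : HasMultiplexingGain C rn) :
    HasDiversity (fun η => errorProb (C η) η (L * (C η).rate + backoff C rn η)) (1 - rn) := by
  have hL' : (0 : ℝ) < L := by positivity
  obtain ⟨K, hK, hlow⟩ := eventually_le_errorProb (C := C) (rn := rn) hL
  refine hasDiversity_of_le_of_le hK (by positivity) ?_ ?_ hlow
    (eventually_errorProb_le hL hrn hC)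
  · have h := tendsto_min_rate_sub hrate
    rwa [min_eq_right (by linarith), ← neg_sub] at h
  · have h := ((tendsto_threshold hC hrate).div_const (L : ℝ)).sub_const 1
    rw [mul_div_cancel_left₀ _ hL'.ne', ← neg_sub] at h
    refine h.congr' ?_
    filter_upwards [eventually_gt_atTop 1] with η hη
    have hΛ : 0 < Real.logb 2 η := Real.logb_pos one_lt_two hη
    field_simp

lemma hasDiversity_zero (hL : 1 ≤ L) (hrn1 : 1 ≤ rn) (hrate : HasMultiplexingGain C rn) :
    HasDiversity (fun η => errorProb (C η) η (L * (C η).rate + backoff C rn η)) 0 := by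
  have hL' : (0 : ℝ) < L := by positivity
  obtain ⟨K, hK, hlow⟩ := eventually_le_errorProb (C := C) (rn := rn) hL
  refine hasDiversity_of_le_of_le (v := fun _ => 0) hK hL' ?_ (by simp) hlow
    (Eventually.of_forall fun η => ?_)
  · have h := tendsto_min_rate_sub hrate
    rw [min_eq_left (by linarith)] at h
    rwa [neg_zero]
  · rw [Real.rpow_zero, mul_one]
    exact errorProb_le_natCast _ _ _

end Family

lemma dmtCurve_one_one {x : ℝ} (h0 : 0 ≤ x) (h1 : x < 1) : dmtCurve 1 1 x = 1 - x := by
  have h : ⌊x⌋ = 0 := Int.floor_eq_zero_iff.2 ⟨h0, h1⟩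
  simp [dmtCurve, h]
  ring

end Rateless

theorem corollary1 (L : ℕ) (hL : 1 ≤ L) (rn : ℝ) (hrn : 0 ≤ rn) :
    (∃ C : ℝ → Rateless.PermCode L,
      Rateless.ApproxUniversal C ∧ Rateless.HasMultiplexingGain C rn) ∧
    ∀ C : ℝ → Rateless.PermCode L,
      Rateless.ApproxUniversal C → Rateless.HasMultiplexingGain C rn →
      ∃ δ : ℝ → ℝ, (∀ η, 0 ≤ δ η) ∧
        Filter.Tendsto (fun η => δ η / Real.logb 2 η) Filter.atTop (nhds 0) ∧
        (∀ l : ℕ, 1 ≤ l → l ≤ L → ((l : ℝ) - 1) / L ≤ rn → rn < (l : ℝ) / L →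
          ∃ r d : ℝ, r = rn * (L / l) ∧ d = Rateless.dmtCurve 1 1 (l * r / L) ∧
            Rateless.HasEffectiveGain
              (fun η => Rateless.avgRate (C η) η (L * (C η).rate + δ η)) r ∧
            Rateless.HasDiversity
              (fun η => Rateless.errorProb (C η) η (L * (C η).rate + δ η)) d) ∧
        (1 ≤ rn →
          Rateless.HasDiversity
            (fun η => Rateless.errorProb (C η) η (L * (C η).rate + δ η)) 0) := by
  refine ⟨Rateless.exists_approxUniversal L hL rn hrn, fun C hC hrate =>
    ⟨Rateless.backoff C rn, Rateless.backoff_nonneg C rn, Rateless.tendsto_backoff hC hrate,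
      fun l hl hlL h1 h2 => ?_, fun h => Rateless.hasDiversity_zero hL h hrate⟩⟩
  have hL' : (0 : ℝ) < L := by positivity
  have hl' : (0 : ℝ) < l := by positivity
  have hrn1 : rn < 1 :=
    h2.trans_le ((div_le_one hL').2 (by exact_mod_cast hlL))
  refine ⟨_, _, rfl, rfl, Rateless.hasEffectiveGain_avgRate hL hC hrate hl hlL h1 h2, ?_⟩
  have harg : (l : ℝ) * (rn * (L / l)) / L = rn := by field_simp
  rw [harg, Rateless.dmtCurve_one_one hrn hrn1]
  exact Rateless.hasDiversity_of_lt_one hL hrn hrn1 hC hrate
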